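/- Let $R$ be the ring of integers of a number field, $R^\times=R\setminus\{0\}$, and let $\mathcal T[R]$ be the universal (unital) C*-algebra generated by elements $u^x$ ($x\in R$), $s_a$ ($a\in R^\times$) and $e_I$ ($I$ a non-zero ideal of $R$) subject to the following relations. - The $u^x$ are unitaries with $u^xu^y=u^{x+y}$, the $s_a$ are isometries with $s_as_b=s_{ab}$, and $s_au^x=u^{ax}s_a$ for all $x,y\in R$, $a,b\in R^\times$. - The $e_I$ are projections with $e_{I\cap J}=e_Ie_J$ and $e_R=1$. - $s_ae_Is_a^*=e_{aI}$. - $u^xe_I=e_Iu^x$ if $x\in I$, and $e_Iu^xe_I=0$ if $x\notin I$. Let $\bar{\mathcal D}\subset\mathcal T[R]$ be the C*-subalgebra generated by all $u^xe_Iu^{-x}$. For a non-zero ideal $I$ put $f_I=\sum_{x\in R/I}u^xe_Iu^{-x}$ (each summand depends only on the class of $x$). For a non-zero prime ideal $P$ and $k\ge 1$ put $\varepsilon_{P^k}=f_{P^{k-1}}-f_{P^k}$. Let $\bar{\mathcal D}_P$ be the C*-subalgebra generated by all $u^xe_{P^k}u^{-x}$ with $x\in R$, $k\ge 0$, and let $\mathcal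 D_P$ be the closed ideal of $\bar{\mathcal D}_P$ generated by the $\varepsilon_{P^k}$, $k\ge 1$. Fix an enumeration $P_1,P_2,\dots$ (without repetition) of all non-zero prime ideals of $R$. For $n\ge 1$ let $\mathcal D_n=\mathcal D_{P_1}\mathcal D_{P_2}\cdots\mathcal D_{P_n}$, the closed linear span of the products $d_1d_2\cdots d_n$ with $d_i\in\mathcal D_{P_i}$. Theorem. Let $\alpha:\mathcal T[R]\to A$ be a (not necessarily unital) $*$-homomorphism into an arbitrary C*-algebra $A$. The following are equivalent: (a) $\alpha$ is injective; (b) $\alpha$ is injective on $\bar{\mathcal D}$; (c) $\alpha$ is injective on $\mathcal D_n$ for each $n\ge 1$. -/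

import Mathlib

open scoped nonZeroDivisors NumberField

noncomputable section

namespace NumberFieldToeplitz

/-! ### The free unital complex *-algebra on a set of generators -/

/-- The free unital complex *-algebra on `X`: complex linear combinations of words in the letters
`(x, false)`, standing for `x`, and `(x, true)`, standing for `x*`. -/
abbrev FreeStarAlgebra (X : Type*) : Type _ := MonoidAlgebra ℂ (FreeMonoid (X × Bool))

namespace FreeStarAlgebra

variable {X : Type*}

/-- The element of the free *-algebra given by a letter. -/
def letter (x : X × Bool) : FreeStarAlgebra X :=
  MonoidAlgebra.of ℂ (FreeMonoid (X × Bool)) (FreeMonoid.of x)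

/-- The generator of the free *-algebra belonging to `x`. -/
def gen (x : X) : FreeStarAlgebra X := letter (x, false)

theorem induction {motive : FreeStarAlgebra X → Prop}
    (scalar : ∀ c : ℂ, motive (algebraMap ℂ _ c))
    (letter : ∀ l, motive (letter l))
    (mul : ∀ a b, motive a → motive b → motive (a * b))
    (add : ∀ a b, motive a → motive b → motive (a + b)) (a : FreeStarAlgebra X) : motive a := by
  have hw : ∀ w : FreeMonoid (X × Bool),
      motive (MonoidAlgebra.of ℂ (FreeMonoid (X × Bool)) w) := by
    intro w
    induction w using FreeMonoid.recOn with
    | one => simpa using scalar 1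
    | of_mul x xs h =>
      rw [map_mul]
      exact mul _ _ (letter x) h
  refine MonoidAlgebra.induction_on (motive := motive) a hw add ?_
  intro r f hf
  have := mul _ _ (scalar r) hf
  rwa [← Algebra.smul_def] at this

/-- The conjugate-linear antimultiplicative map exchanging the letters `x` and `x*`, as a ring
homomorphism to the opposite ring. -/
def starHom : FreeStarAlgebra X →+* (FreeStarAlgebra X)ᵐᵒᵖ :=
  MonoidAlgebra.liftNCRingHom
    ((algebraMap ℂ (FreeStarAlgebra X)ᵐᵒᵖ).comp (starRingEnd ℂ))
    (FreeMonoid.lift fun l : X × Bool => MulOpposite.op (letter (l.1, !l.2)))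
    (fun c _ => Algebra.commute_algebraMap_left (starRingEnd ℂ c) _)

theorem starHom_algebraMap (c : ℂ) :
    starHom (algebraMap ℂ (FreeStarAlgebra X) c) =
      MulOpposite.op (algebraMap ℂ (FreeStarAlgebra X) (star c)) := by
  have h : algebraMap ℂ (FreeStarAlgebra X) c =
      MonoidAlgebra.single (1 : FreeMonoid (X × Bool)) c := rfl
  rw [h]
  refine (MonoidAlgebra.liftNC_single _ _ _ _).trans ?_
  simp

theorem starHom_letter (l : X × Bool) :
    starHom (letter l) = MulOpposite.op (letter (l.1, !l.2)) := by
  refine (MonoidAlgebra.liftNC_single _ _ _ _).trans ?_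
  rw [AddMonoidHom.coe_coe, map_one, one_mul]
  simp

instance : StarRing (FreeStarAlgebra X) where
  star a := (starHom a).unop
  star_involutive a := by
    induction a using FreeStarAlgebra.induction with
    | scalar c =>
      beta_reduce
      rw [starHom_algebraMap, MulOpposite.unop_op, starHom_algebraMap, star_star,
        MulOpposite.unop_op]
    | letter l => simp [starHom_letter]
    | mul a b ha hb => simp [ha, hb]
    | add a b ha hb => simp [ha, hb]
  star_mul a b := by simp
  star_add a b := by simp

theorem star_def (a : FreeStarAlgebra X) : star a = (starHom a).unop := rfl

instance : StarModule ℂ (FreeStarAlgebra X) where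
  star_smul c a := by
    rw [Algebra.smul_def, star_mul, star_def (algebraMap _ _ _), starHom_algebraMap,
      MulOpposite.unop_op, ← Algebra.commutes, ← Algebra.smul_def]

theorem star_letter (l : X × Bool) : star (letter l) = letter (l.1, !l.2) := by
  rw [star_def, starHom_letter, MulOpposite.unop_op]

end FreeStarAlgebra

/-! ### Generators and relations of the Toeplitz algebra -/

variable (R : Type*) [CommRing R] [IsDomain R]

/-- The non-zero ideals of `R`. -/
abbrev NonzeroIdeal : Type _ := {I : Ideal R // I ≠ ⊥}

namespace NonzeroIdeal

variable {R}

/-- The unit ideal `R`. -/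
def top : NonzeroIdeal R := ⟨⊤, top_ne_bot⟩

/-- The intersection `I ∩ J`. -/
def inf (I J : NonzeroIdeal R) : NonzeroIdeal R :=
  ⟨I.1 ⊓ J.1, fun h => (mul_ne_zero (M₀ := Ideal R) I.2 J.2)
    (le_bot_iff.1 (Ideal.mul_le_inf.trans h.le))⟩

/-- The ideal `aI`, for a non-zero element `a`. -/
def smul (a : R⁰) (I : NonzeroIdeal R) : NonzeroIdeal R :=
  ⟨Ideal.span {(a : R)} * I.1, mul_ne_zero (M₀ := Ideal R)
    (fun h => nonZeroDivisors.coe_ne_zero a (Ideal.span_singleton_eq_bot.1 h)) I.2⟩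

/-- The power `P ^ n` of a non-zero prime ideal. -/
def primePow (P : IsDedekindDomain.HeightOneSpectrum R) (n : ℕ) : NonzeroIdeal R :=
  ⟨P.asIdeal ^ n, pow_ne_zero (M₀ := Ideal R) n P.ne_bot⟩

end NonzeroIdeal

/-- The generators: `u x` for `x ∈ R`, `s a` for `0 ≠ a ∈ R` (the domain `R` has `R⁰ = R ∖ {0}`),
and `e I` for `I` a non-zero ideal. -/
inductive Generator : Type _
  | u (x : R)
  | s (a : R⁰)
  | e (I : NonzeroIdeal R)

/-- The free *-algebra on the generators of the Toeplitz algebra. -/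
abbrev FreeToeplitz : Type _ := FreeStarAlgebra (Generator R)

namespace FreeToeplitz

variable {R}

/-- The free generator `u x`. -/
def u (x : R) : FreeToeplitz R := FreeStarAlgebra.gen (Generator.u x)
/-- The free generator `s a`. -/
def s (a : R⁰) : FreeToeplitz R := FreeStarAlgebra.gen (Generator.s a)
/-- The free generator `e I`. -/
def e (I : NonzeroIdeal R) : FreeToeplitz R := FreeStarAlgebra.gen (Generator.e I)

/-- The defining relations; `Rel x y` stands for the relation `x = y`. -/
inductive Rel : FreeToeplitz R → FreeToeplitz R → Prop
  /- `u` is a unitary representation of the additive group, `s` a representation of the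
  multiplicative semigroup by isometries, and they are covariant. -/
  | u_star_mul_self (x : R) : Rel (star (u x) * u x) 1
  | u_mul_star_self (x : R) : Rel (u x * star (u x)) 1
  | u_mul_u (x y : R) : Rel (u x * u y) (u (x + y))
  | s_star_mul_self (a : R⁰) : Rel (star (s a) * s a) 1
  | s_mul_s (a b : R⁰) : Rel (s a * s b) (s (a * b))
  | s_mul_u (a : R⁰) (x : R) : Rel (s a * u x) (u ((a : R) * x) * s a)
  /- The `e I` are projections, multiplicative for intersections. -/
  | e_star (I : NonzeroIdeal R) : Rel (star (e I)) (e I)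
  | e_mul_self (I : NonzeroIdeal R) : Rel (e I * e I) (e I)
  | e_inf (I J : NonzeroIdeal R) : Rel (e (I.inf J)) (e I * e J)
  | e_top : Rel (e NonzeroIdeal.top) 1
  /- The isometries move `e I` to `e (a I)`. -/
  | s_e_s (a : R⁰) (I : NonzeroIdeal R) : Rel (s a * e I * star (s a)) (e (I.smul a))
  /- The relations between the translations and the ideals. -/
  | u_comm_e (I : NonzeroIdeal R) (x : R) (hx : x ∈ I.1) : Rel (u x * e I) (e I * u x)
  | e_u_e (I : NonzeroIdeal R) (x : R) (hx : x ∉ I.1) : Rel (e I * u x * e I) 0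

/-- The C*-seminorms on the free *-algebra for which the defining relations hold, that is, the
seminorms `y ↦ ‖π y‖` for unital *-homomorphisms `π` to C*-algebras respecting the relations. -/
structure IsToeplitzSeminorm (p : Seminorm ℂ (FreeToeplitz R)) : Prop where
  mul_le : ∀ x y, p (x * y) ≤ p x * p y
  star_mul_self : ∀ x, p (star x * x) = p x ^ 2
  rel : ∀ x y, Rel x y → p (x - y) = 0

namespace IsToeplitzSeminorm

variable {p : Seminorm ℂ (FreeToeplitz R)}

theorem star_eq (hp : IsToeplitzSeminorm p) (x : FreeToeplitz R) : p (star x) = p x := by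
  have key : ∀ y, p y ≤ p (star y) := by
    intro y
    rcases (apply_nonneg p y).eq_or_lt with h | h
    · rw [← h]; exact apply_nonneg p _
    · have h1 := hp.star_mul_self y
      have h2 := hp.mul_le (star y) y
      nlinarith
  refine le_antisymm ?_ (key x)
  simpa using key (star x)

theorem eq_of_rel (hp : IsToeplitzSeminorm p) {x y : FreeToeplitz R} (h : Rel x y) :
    p x = p y := by
  have h1 := hp.rel x y h
  have h2 := abs_sub_map_le_sub p x y
  rw [h1] at h2
  linarith [abs_nonpos_iff.1 h2]

theorem one_le (hp : IsToeplitzSeminorm p) : p 1 ≤ 1 := by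
  have h := hp.star_mul_self 1
  rw [star_one, one_mul] at h
  nlinarith [sq_nonneg (p 1 - 1)]

theorem gen_le (hp : IsToeplitzSeminorm p) (g : Generator R) :
    p (FreeStarAlgebra.gen g) ≤ 1 := by
  have hiso : ∀ x, Rel (star x * x) 1 → p x ≤ 1 := by
    intro x hx
    have h1 := hp.star_mul_self x
    rw [hp.eq_of_rel hx] at h1
    nlinarith [hp.one_le, apply_nonneg p x]
  cases g with
  | u x => exact hiso (u x) (Rel.u_star_mul_self x)
  | s a => exact hiso (s a) (Rel.s_star_mul_self a)
  | e I =>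
    change p (e I) ≤ 1
    have h1 := hp.star_mul_self (e I)
    have h2 : p (star (e I) * e I - e I * e I) = 0 := by
      rw [← sub_mul]
      refine le_antisymm ((hp.mul_le _ _).trans ?_) (apply_nonneg p _)
      rw [hp.rel _ _ (Rel.e_star I), zero_mul]
    have h3 := abs_sub_map_le_sub p (star (e I) * e I) (e I * e I)
    rw [h2] at h3
    have h4 := abs_nonpos_iff.1 h3
    have h5 := hp.eq_of_rel (Rel.e_mul_self I)
    nlinarith [apply_nonneg p (e I)]

end IsToeplitzSeminorm

theorem exists_bound (x : FreeToeplitz R) :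
    ∃ C, ∀ p : Seminorm ℂ (FreeToeplitz R), IsToeplitzSeminorm p → p x ≤ C := by
  induction x using FreeStarAlgebra.induction with
  | scalar c =>
    refine ⟨‖c‖, fun p hp => ?_⟩
    rw [Algebra.algebraMap_eq_smul_one, map_smul_eq_mul]
    exact mul_le_of_le_one_right (norm_nonneg c) hp.one_le
  | letter l =>
    refine ⟨1, fun p hp => ?_⟩
    obtain ⟨g, b⟩ := l
    cases b with
    | false => exact hp.gen_le g
    | true =>
      have h : FreeStarAlgebra.letter (g, true) = star (FreeStarAlgebra.gen g) :=
        (FreeStarAlgebra.star_letter (g, false)).symm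
      rw [h, hp.star_eq]
      exact hp.gen_le g
  | mul a b ha hb =>
    obtain ⟨C, hC⟩ := ha
    obtain ⟨D, hD⟩ := hb
    refine ⟨C * D, fun p hp => (hp.mul_le a b).trans ?_⟩
    exact mul_le_mul (hC p hp) (hD p hp) (apply_nonneg p b)
      ((apply_nonneg p a).trans (hC p hp))
  | add a b ha hb =>
    obtain ⟨C, hC⟩ := ha
    obtain ⟨D, hD⟩ := hb
    exact ⟨C + D, fun p hp => (map_add_le_add p a b).trans (add_le_add (hC p hp) (hD p hp))⟩

variable (R) in
/-- The largest C*-seminorm on the free *-algebra for which the defining relations hold. -/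
def maxSeminorm : Seminorm ℂ (FreeToeplitz R) := sSup {p | IsToeplitzSeminorm p}

theorem bddAbove : BddAbove {p : Seminorm ℂ (FreeToeplitz R) | IsToeplitzSeminorm p} := by
  rw [Seminorm.bddAbove_iff, bddAbove_pi]
  intro x
  obtain ⟨C, hC⟩ := exists_bound x
  refine ⟨C, ?_⟩
  rintro _ ⟨_, ⟨p, hp, rfl⟩, rfl⟩
  exact hC p hp

theorem isToeplitzSeminorm_zero : IsToeplitzSeminorm (0 : Seminorm ℂ (FreeToeplitz R)) :=
  ⟨fun _ _ => by simp, fun _ => by simp, fun _ _ _ => by simp⟩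

theorem le_maxSeminorm {p : Seminorm ℂ (FreeToeplitz R)} (hp : IsToeplitzSeminorm p)
    (x : FreeToeplitz R) : p x ≤ maxSeminorm R x :=
  le_csSup bddAbove hp x

theorem maxSeminorm_le {x : FreeToeplitz R} {C : ℝ}
    (h : ∀ p : Seminorm ℂ (FreeToeplitz R), IsToeplitzSeminorm p → p x ≤ C) :
    maxSeminorm R x ≤ C := by
  have : Nonempty {p : Seminorm ℂ (FreeToeplitz R) | IsToeplitzSeminorm p} :=
    ⟨⟨0, isToeplitzSeminorm_zero⟩⟩
  rw [maxSeminorm, Seminorm.sSup_apply bddAbove]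
  exact ciSup_le fun p => h p p.2

theorem isToeplitzSeminorm_maxSeminorm : IsToeplitzSeminorm (maxSeminorm R) where
  mul_le x y := maxSeminorm_le fun p hp => (hp.mul_le x y).trans <|
    mul_le_mul (le_maxSeminorm hp x) (le_maxSeminorm hp y) (apply_nonneg p y)
      (apply_nonneg _ x)
  star_mul_self x := by
    refine le_antisymm (maxSeminorm_le fun p hp => ?_) ?_
    · rw [hp.star_mul_self]
      exact pow_le_pow_left₀ (apply_nonneg p x) (le_maxSeminorm hp x) 2
    · have h : maxSeminorm R x ≤ √(maxSeminorm R (star x * x)) := maxSeminorm_le fun p hp =>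
        Real.le_sqrt_of_sq_le ((hp.star_mul_self x).symm.le.trans (le_maxSeminorm hp _))
      calc maxSeminorm R x ^ 2 ≤ √(maxSeminorm R (star x * x)) ^ 2 :=
            pow_le_pow_left₀ (apply_nonneg _ x) h 2
        _ = maxSeminorm R (star x * x) := Real.sq_sqrt (apply_nonneg _ _)
  rel x y h := le_antisymm (maxSeminorm_le fun p hp => (hp.rel x y h).le) (apply_nonneg _ _)

instance : SeminormedRing (FreeToeplitz R) where
  __ := (maxSeminorm R).toAddGroupSeminorm.toSeminormedAddCommGroup
  __ := (inferInstance : Ring (FreeToeplitz R))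
  norm_mul_le := isToeplitzSeminorm_maxSeminorm.mul_le

theorem norm_def (x : FreeToeplitz R) : ‖x‖ = maxSeminorm R x := rfl

instance : NormedAlgebra ℂ (FreeToeplitz R) where
  norm_smul_le c x := (map_smul_eq_mul (maxSeminorm R) c x).le

instance : NormedStarGroup (FreeToeplitz R) where
  norm_star_le x := (isToeplitzSeminorm_maxSeminorm.star_eq x).le

end FreeToeplitz

/-! ### The Toeplitz algebra -/

/-- The Toeplitz algebra of `R`, the universal C*-algebra on the generators `u x`, `s a`, `e I`
with the given relations: the completion of the free *-algebra in the largest C*-seminorm for which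
the relations hold (elements of seminorm zero being identified with zero). -/
def ToeplitzAlgebra : Type _ := UniformSpace.Completion (FreeToeplitz R)

namespace ToeplitzAlgebra

open UniformSpace

variable {R}

instance : NormedRing (ToeplitzAlgebra R) :=
  inferInstanceAs (NormedRing (Completion (FreeToeplitz R)))

instance : Algebra ℂ (ToeplitzAlgebra R) :=
  inferInstanceAs (Algebra ℂ (Completion (FreeToeplitz R)))

instance : CompleteSpace (ToeplitzAlgebra R) :=
  inferInstanceAs (CompleteSpace (Completion (FreeToeplitz R)))

/-- The canonical map from the free *-algebra. -/
def mk : FreeToeplitz R →+* ToeplitzAlgebra R :=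
  Completion.coeRingHom

theorem continuous_mk : Continuous (mk (R := R)) := Completion.continuous_coe _

theorem norm_mk (x : FreeToeplitz R) : ‖mk x‖ = ‖x‖ := Completion.norm_coe x

theorem induction {motive : ToeplitzAlgebra R → Prop} (a : ToeplitzAlgebra R)
    (closed : IsClosed {a | motive a}) (mk : ∀ x, motive (mk x)) : motive a :=
  Completion.induction_on a closed mk

theorem mk_algebraMap (c : ℂ) :
    mk (algebraMap ℂ (FreeToeplitz R) c) = algebraMap ℂ (ToeplitzAlgebra R) c := rfl

instance : NormedAlgebra ℂ (ToeplitzAlgebra R) where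
  norm_smul_le c x := by
    rw [Algebra.smul_def]
    refine (norm_mul_le _ _).trans (mul_le_mul_of_nonneg_right ?_ (norm_nonneg _))
    rw [← mk_algebraMap, norm_mk, Algebra.algebraMap_eq_smul_one]
    refine (norm_smul_le c _).trans (mul_le_of_le_one_right (norm_nonneg c) ?_)
    exact FreeToeplitz.isToeplitzSeminorm_maxSeminorm.one_le

instance : Star (ToeplitzAlgebra R) where
  star := Completion.map (star : FreeToeplitz R → FreeToeplitz R)

theorem continuous_star' : Continuous (star : ToeplitzAlgebra R → ToeplitzAlgebra R) :=
  Completion.continuous_map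

theorem star_mk (x : FreeToeplitz R) : star (mk x) = mk (star x) :=
  Completion.map_coe (f := (star : FreeToeplitz R → FreeToeplitz R))
    (star_isometry (E := FreeToeplitz R)).uniformContinuous x

instance : StarRing (ToeplitzAlgebra R) where
  star_involutive a := by
    induction a using induction with
    | closed => exact isClosed_eq (continuous_star'.comp continuous_star') continuous_id
    | mk x => rw [star_mk, star_mk, star_star]
  star_mul a b := by
    induction a using induction with
    | closed =>
      exact isClosed_eq (continuous_star'.comp (continuous_mul_const b))
        ((continuous_const_mul (star b)).comp continuous_star')
    | mk x =>
      induction b using induction with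
      | closed =>
        exact isClosed_eq (continuous_star'.comp (continuous_const_mul (mk x)))
          ((continuous_mul_const (star (mk x))).comp continuous_star')
      | mk y => rw [← map_mul, star_mk, star_mk, star_mk, star_mul, map_mul]
  star_add a b := by
    induction a using induction with
    | closed =>
      exact isClosed_eq (continuous_star'.comp (continuous_add_const b))
        ((continuous_add_const (star b)).comp continuous_star')
    | mk x =>
      induction b using induction with
      | closed =>
        exact isClosed_eq (continuous_star'.comp (continuous_const_add (mk x)))
          ((continuous_const_add (star (mk x))).comp continuous_star')
      | mk y => rw [← map_add, star_mk, star_mk, star_mk, star_add, map_add]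

/-- The Toeplitz algebra is a unital C*-algebra. -/
instance : CStarAlgebra (ToeplitzAlgebra R) where
  norm_mul_self_le a := by
    induction a using induction with
    | closed =>
      exact isClosed_le (continuous_norm.mul continuous_norm)
        (continuous_norm.comp (continuous_star'.mul continuous_id))
    | mk x =>
      rw [star_mk, ← map_mul, norm_mk, norm_mk, FreeToeplitz.norm_def, FreeToeplitz.norm_def,
        FreeToeplitz.isToeplitzSeminorm_maxSeminorm.star_mul_self, sq]
  star_smul c a := by
    induction a using induction with
    | closed =>
      exact isClosed_eq (continuous_star'.comp (continuous_const_smul c))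
        ((continuous_const_smul (star c)).comp continuous_star')
    | mk x =>
      rw [Algebra.smul_def, Algebra.smul_def, ← mk_algebraMap, ← mk_algebraMap, ← map_mul,
        star_mk, star_mk, ← map_mul, ← Algebra.smul_def, ← Algebra.smul_def, star_smul]

/-- The unitary `u^x`. -/
def u (x : R) : ToeplitzAlgebra R := mk (FreeToeplitz.u x)
/-- The isometry `s_a`. -/
def s (a : R⁰) : ToeplitzAlgebra R := mk (FreeToeplitz.s a)
/-- The projection `e_I`. -/
def e (I : NonzeroIdeal R) : ToeplitzAlgebra R := mk (FreeToeplitz.e I)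

variable (R) in
/-- The canonical commutative subalgebra `D̄`: the C*-subalgebra generated by all
`u^x e_I u^{-x}`. -/
def Dbar : NonUnitalStarSubalgebra ℂ (ToeplitzAlgebra R) :=
  (NonUnitalStarAlgebra.adjoin ℂ
    {d | ∃ (x : R) (I : NonzeroIdeal R), d = u x * e I * u (-x)}).topologicalClosure

/-- The C*-subalgebra `D̄_P` of `D̄` generated by all `u^x e_{P^n} u^{-x}`, `n ≥ 0`. -/
def DbarPrime (P : IsDedekindDomain.HeightOneSpectrum R) :
    NonUnitalStarSubalgebra ℂ (ToeplitzAlgebra R) :=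
  (NonUnitalStarAlgebra.adjoin ℂ
    {d | ∃ (x : R) (n : ℕ),
      d = u x * e (NonzeroIdeal.primePow P n) * u (-x)}).topologicalClosure

/-- The projection `f_I`, the sum of `u^x e_I u^{-x}` over representatives `x` of the classes in
`R / I`. The summand depends only on the class of `x`. The quotient `R / I` is finite when `R` is
the ring of integers of a number field, the only case in which this is used. -/
def f (I : NonzeroIdeal R) : ToeplitzAlgebra R :=
  ∑ᶠ c : R ⧸ I.1, u (Quotient.out c) * e I * u (-Quotient.out c)

/-- The projection `ε_{P^n} = f_{P^{n-1}} - f_{P^n}`, for `n ≥ 1`. -/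
def epsilon (P : IsDedekindDomain.HeightOneSpectrum R) (n : ℕ) : ToeplitzAlgebra R :=
  f (NonzeroIdeal.primePow P (n - 1)) - f (NonzeroIdeal.primePow P n)

/-- The closed two-sided ideal `D_P` of the unital C*-algebra `D̄_P` generated by the `ε_{P^n}`,
`n ≥ 1`. -/
def DPrime (P : IsDedekindDomain.HeightOneSpectrum R) : Submodule ℂ (ToeplitzAlgebra R) :=
  (Submodule.span ℂ {z | ∃ d ∈ DbarPrime P, ∃ n : ℕ, 1 ≤ n ∧ ∃ d' ∈ DbarPrime P,
    z = d * epsilon P n * d'}).topologicalClosure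

/-- For a sequence `P 0, P 1, …` of primes, the product `D_n` of `D_{P 0}, …, D_{P (n - 1)}`: the
closed linear span of the products `d_0 d_1 ⋯ d_{n-1}` with `d_i` in `D_{P i}`. -/
def D (P : ℕ → IsDedekindDomain.HeightOneSpectrum R) (n : ℕ) :
    Submodule ℂ (ToeplitzAlgebra R) :=
  ((List.ofFn fun i : Fin n => DPrime (P i)).prod).topologicalClosure

end ToeplitzAlgebra

end NumberFieldToeplitz

end

/-! Since D_n ⊆ D̄, only (c) ⇒ (a) has content. The projections u^x e_I u^{-x} multiply like
indicators of the cosets x + I, so the monomials s_a^* p u^z s_b, with p zero or a coset projection,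
span a dense *-subalgebra. Such a monomial has a degree in the affine group K ⋊ K^×, trivial exactly
when a = b and z = 0, and a monomial of trivial degree is zero or again a coset projection. Write E
for the passage to the part of degree one. It is never constructed as a conditional expectation; two
facts about it suffice.

Domination: ‖E(t)‖ ≤ ‖α(t)‖ for t in the span (`norm_sum_degree_one_le`). The element E(t) is a
combination of commuting projections, so a character attains its norm, and on finitely many coset
projections a character looks like evaluation at some coset x + I (`exists_norm_sum_cosetProj_le`).
Some D_n contains a non-zero q on which these projections act by 1 or 0 as the character prescribes,
and which compresses every monomial of non-trivial degree to zero (`exists_atom_compression`). Then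
q^* t q = λ q^* q with ‖E(t)‖ ≤ |λ|. By (c), α(q) ≠ 0, so |λ| ≤ ‖α(t)‖. That q ≠ 0 is read off from
a concrete representation, `idealRep`.

Faithfulness: a representation π tensored with the permutations given by the degree is again a
representation, `gradedRep`, whose diagonal coefficients are those of π ∘ E. If α(y) = 0, domination
applied to y^* y shows that `gradedRep` of y annihilates all families with one entry. The affine
group is amenable, and averaging over Følner sets then yields π(y) = 0
(`eq_zero_of_gradedRep_single_eq_zero`). By the GNS construction some π is non-zero at any given y ≠
0 (`exists_representation_ne_zero`), so y = 0. -/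

noncomputable section

namespace NumberFieldToeplitz

/-! ### Universal properties of the free *-algebra and of the Toeplitz algebra. -/

namespace FreeStarAlgebra

variable {X B : Type*} [Ring B] [StarRing B] [Algebra ℂ B]

/-- The unital homomorphism underlying `FreeStarAlgebra.lift`. -/
def liftAlgHom (v : X → B) : FreeStarAlgebra X →ₐ[ℂ] B :=
  MonoidAlgebra.lift ℂ B (FreeMonoid (X × Bool))
    (FreeMonoid.lift fun l : X × Bool => if l.2 then star (v l.1) else v l.1)

theorem liftAlgHom_letter (v : X → B) (l : X × Bool) :
    liftAlgHom v (letter l) = if l.2 then star (v l.1) else v l.1 := by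
  simp [liftAlgHom, letter]

variable [StarModule ℂ B]

/-- The free unital complex *-algebra has the expected universal property. -/
def lift (v : X → B) : FreeStarAlgebra X →⋆ₐ[ℂ] B where
  toAlgHom := liftAlgHom v
  map_star' a := by
    change liftAlgHom v (star a) = star (liftAlgHom v a)
    induction a using FreeStarAlgebra.induction with
    | scalar c =>
      rw [← algebraMap_star_comm, AlgHom.commutes, AlgHom.commutes, algebraMap_star_comm]
    | letter l =>
      rw [star_letter, liftAlgHom_letter, liftAlgHom_letter]
      obtain ⟨x, b⟩ := l
      cases b <;> simp
    | mul a b ha hb => simp [ha, hb]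
    | add a b ha hb => simp [ha, hb]

theorem lift_gen (v : X → B) (x : X) : lift v (gen x) = v x := by
  change liftAlgHom v (letter (x, false)) = _
  simp [liftAlgHom_letter]

end FreeStarAlgebra

namespace ToeplitzAlgebra

open UniformSpace FreeToeplitz

variable {R : Type*} [CommRing R] [IsDomain R] {B : Type*} [CStarAlgebra B]

/-- The norm of `B` pulled back to the free *-algebra is a C*-seminorm respecting the relations,
hence is dominated by the largest one. This is what allows the extension to the completion. -/
theorem norm_lift_le (v : Generator R → B)
    (hv : ∀ x y : FreeToeplitz R, FreeToeplitz.Rel x y → FreeStarAlgebra.lift v x = FreeStarAlgebra.lift v y)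
    (x : FreeToeplitz R) : ‖FreeStarAlgebra.lift v x‖ ≤ ‖x‖ := by
  let p : Seminorm ℂ (FreeToeplitz R) :=
    (normSeminorm ℂ B).comp (FreeStarAlgebra.lift v).toAlgHom.toLinearMap
  have hp : ∀ y, p y = ‖FreeStarAlgebra.lift v y‖ := fun _ => rfl
  rw [← hp, norm_def]
  refine le_maxSeminorm ⟨fun x y => ?_, fun x => ?_, fun x y h => ?_⟩ x
  · rw [hp, hp, hp, map_mul]
    exact norm_mul_le _ _
  · rw [hp, hp, map_mul, map_star, CStarRing.norm_star_mul_self, sq]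
  · rw [hp, map_sub, hv x y h, sub_self, norm_zero]

theorem continuous_lift (v : Generator R → B)
    (hv : ∀ x y : FreeToeplitz R, FreeToeplitz.Rel x y →
      FreeStarAlgebra.lift v x = FreeStarAlgebra.lift v y) :
    Continuous (FreeStarAlgebra.lift v : FreeToeplitz R →⋆ₐ[ℂ] B).toRingHom :=
  AddMonoidHomClass.continuous_of_bound
    (FreeStarAlgebra.lift v : FreeToeplitz R →⋆ₐ[ℂ] B).toRingHom 1
    (fun x => by rw [one_mul]; exact norm_lift_le v hv x)

/-- The universal property of the Toeplitz algebra. -/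
def lift (v : Generator R → B)
    (hv : ∀ x y : FreeToeplitz R, FreeToeplitz.Rel x y → FreeStarAlgebra.lift v x = FreeStarAlgebra.lift v y) :
    ToeplitzAlgebra R →⋆ₐ[ℂ] B :=
  have hcont := continuous_lift v hv
  let φ : ToeplitzAlgebra R →+* B := Completion.extensionHom _ hcont
  have hφ : ∀ x, φ (mk x) = FreeStarAlgebra.lift v x := Completion.extensionHom_coe _ hcont
  have hφc : Continuous φ := Completion.continuous_extension
  { φ with
    commutes' := fun c => by
      change φ (algebraMap ℂ _ c) = _
      rw [← mk_algebraMap, hφ, AlgHomClass.commutes]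
    map_star' := fun a => by
      change φ (star a) = star (φ a)
      induction a using ToeplitzAlgebra.induction with
      | closed => exact isClosed_eq (hφc.comp continuous_star) (continuous_star.comp hφc)
      | mk x => rw [star_mk, hφ, hφ, map_star] }

theorem lift_mk (v : Generator R → B)
    (hv : ∀ x y : FreeToeplitz R, FreeToeplitz.Rel x y → FreeStarAlgebra.lift v x = FreeStarAlgebra.lift v y)
    (x : FreeToeplitz R) : lift v hv (mk x) = FreeStarAlgebra.lift v x :=
  Completion.extensionHom_coe _ (continuous_lift v hv) x

theorem lift_u (v : Generator R → B) (hv) (x : R) : lift v hv (u x) = v (.u x) :=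
  (lift_mk v hv _).trans (FreeStarAlgebra.lift_gen v _)

theorem lift_s (v : Generator R → B) (hv) (a : R⁰) : lift v hv (s a) = v (.s a) :=
  (lift_mk v hv _).trans (FreeStarAlgebra.lift_gen v _)

theorem lift_e (v : Generator R → B) (hv) (I : NonzeroIdeal R) : lift v hv (e I) = v (.e I) :=
  (lift_mk v hv _).trans (FreeStarAlgebra.lift_gen v _)

theorem mk_eq_of_rel {x y : FreeToeplitz R} (h : FreeToeplitz.Rel x y) : mk x = mk y := by
  rw [← sub_eq_zero, ← map_sub, ← norm_eq_zero, norm_mk, norm_def]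
  exact isToeplitzSeminorm_maxSeminorm.rel x y h

/-! ### The relations in the Toeplitz algebra -/

theorem star_u_mul_u (x : R) : star (u x) * u x = 1 := by
  simpa [u, star_mk] using mk_eq_of_rel (FreeToeplitz.Rel.u_star_mul_self x)

theorem u_mul_star_u (x : R) : u x * star (u x) = 1 := by
  simpa [u, star_mk] using mk_eq_of_rel (FreeToeplitz.Rel.u_mul_star_self x)

theorem u_mul_u (x y : R) : u x * u y = u (x + y) := by
  simpa [u] using mk_eq_of_rel (FreeToeplitz.Rel.u_mul_u x y)

theorem star_s_mul_s (a : R⁰) : star (s a) * s a = 1 := by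
  simpa [s, star_mk] using mk_eq_of_rel (FreeToeplitz.Rel.s_star_mul_self a)

theorem s_mul_s (a b : R⁰) : s a * s b = s (a * b) := by
  simpa [s] using mk_eq_of_rel (FreeToeplitz.Rel.s_mul_s a b)

theorem s_mul_u (a : R⁰) (x : R) : s a * u x = u ((a : R) * x) * s a := by
  simpa [s, u] using mk_eq_of_rel (FreeToeplitz.Rel.s_mul_u a x)

theorem star_e (I : NonzeroIdeal R) : star (e I) = e I := by
  simpa [e, star_mk] using mk_eq_of_rel (FreeToeplitz.Rel.e_star I)

theorem e_mul_e (I J : NonzeroIdeal R) : e I * e J = e (I.inf J) := by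
  simpa [e] using (mk_eq_of_rel (FreeToeplitz.Rel.e_inf I J)).symm

theorem e_mul_self (I : NonzeroIdeal R) : e I * e I = e I := by
  simpa [e] using mk_eq_of_rel (FreeToeplitz.Rel.e_mul_self I)

theorem e_top : e (NonzeroIdeal.top : NonzeroIdeal R) = 1 := by
  simpa [e] using mk_eq_of_rel (FreeToeplitz.Rel.e_top (R := R))

theorem s_e_s (a : R⁰) (I : NonzeroIdeal R) : s a * e I * star (s a) = e (I.smul a) := by
  simpa [e, s, star_mk] using mk_eq_of_rel (FreeToeplitz.Rel.s_e_s a I)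

theorem u_comm_e (I : NonzeroIdeal R) (x : R) (hx : x ∈ I.1) : u x * e I = e I * u x := by
  simpa [e, u] using mk_eq_of_rel (FreeToeplitz.Rel.u_comm_e I x hx)

theorem e_u_e (I : NonzeroIdeal R) (x : R) (hx : x ∉ I.1) : e I * u x * e I = 0 := by
  simpa [e, u] using mk_eq_of_rel (FreeToeplitz.Rel.e_u_e I x hx)

theorem u_zero : u (0 : R) = 1 := by
  have h := u_mul_u (0 : R) 0
  rw [add_zero] at h
  calc u (0 : R) = star (u 0) * u 0 * u 0 := by rw [star_u_mul_u, one_mul]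
    _ = 1 := by rw [mul_assoc, h, star_u_mul_u]

theorem star_u (x : R) : star (u x) = u (-x) := by
  calc star (u x) = star (u x) * (u x * u (-x)) := by rw [u_mul_u, add_neg_cancel, u_zero, mul_one]
    _ = u (-x) := by rw [← mul_assoc, star_u_mul_u, one_mul]

theorem s_one : s (1 : R⁰) = 1 := by
  have h := s_mul_s (1 : R⁰) 1
  rw [mul_one] at h
  calc s (1 : R⁰) = star (s 1) * s 1 * s 1 := by rw [star_s_mul_s, one_mul]
    _ = 1 := by rw [mul_assoc, h, star_s_mul_s]

end ToeplitzAlgebra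

namespace ToeplitzAlgebra

variable {R : Type*} [CommRing R] [IsDomain R]

/-! ### The projections belonging to cosets of ideals -/

/-- The projection `u^x e_I u^{-x}` belonging to the coset `x + I`. -/
def cosetProj (x : R) (I : NonzeroIdeal R) : ToeplitzAlgebra R := u x * e I * u (-x)

theorem cosetProj_zero (I : NonzeroIdeal R) : cosetProj 0 I = e I := by
  simp [cosetProj, u_zero]

theorem cosetProj_top (x : R) : cosetProj x NonzeroIdeal.top = 1 := by
  simp [cosetProj, e_top, u_mul_u, u_zero]

theorem star_cosetProj (x : R) (I : NonzeroIdeal R) : star (cosetProj x I) = cosetProj x I := by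
  simp [cosetProj, star_u, star_e, mul_assoc]

theorem u_mul_cosetProj (y x : R) (I : NonzeroIdeal R) :
    u y * cosetProj x I = cosetProj (y + x) I * u y := by
  simp only [cosetProj, mul_assoc, u_mul_u]
  rw [← mul_assoc, u_mul_u]
  congr 4
  ring

theorem cosetProj_eq {x y : R} {I : NonzeroIdeal R} (h : x - y ∈ I.1) :
    cosetProj x I = cosetProj y I := by
  have h1 : u x = u y * u (x - y) := by rw [u_mul_u]; congr 1; ring
  have h2 : u (x - y) * u (-x) = u (-y) := by rw [u_mul_u]; congr 1; ring
  rw [cosetProj, h1, mul_assoc (u y), u_comm_e I _ h, cosetProj, ← h2]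
  simp only [mul_assoc]

theorem e_mul_e_of_le {I J : NonzeroIdeal R} (h : I.1 ≤ J.1) : e I * e J = e I := by
  rw [e_mul_e]
  congr 1
  exact Subtype.ext (inf_eq_left.2 h)

theorem e_mul_e_of_ge {I J : NonzeroIdeal R} (h : J.1 ≤ I.1) : e I * e J = e J := by
  rw [e_mul_e]
  congr 1
  exact Subtype.ext (inf_eq_right.2 h)

theorem cosetProj_mul_cosetProj_self (x : R) (I J : NonzeroIdeal R) :
    cosetProj x I * cosetProj x J = cosetProj x (I.inf J) := by
  have h2 : ∀ t, u (-x) * (u x * t) = t := by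
    intro t
    rw [← mul_assoc, u_mul_u, neg_add_cancel, u_zero, one_mul]
  simp only [cosetProj, mul_assoc, h2]
  rw [← mul_assoc (e I), e_mul_e]

/-- Both projections lie below projections of cosets of the common larger ideal `L`: inserting e_L
on either side of u^{y-x} produces e_L u^{y-x} e_L = 0. -/
theorem cosetProj_mul_eq_zero {x y : R} {I J : NonzeroIdeal R} (L : Ideal R) (hI : I.1 ≤ L)
    (hJ : J.1 ≤ L) (h : x - y ∉ L) : cosetProj x I * cosetProj y J = 0 := by
  let L' : NonzeroIdeal R := ⟨L, fun hL => I.2 (le_bot_iff.1 (hI.trans hL.le))⟩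
  have h1 : e I * (u (-x) * u y) * e J = 0 := by
    rw [u_mul_u, ← e_mul_e_of_le (J := L') hI, ← e_mul_e_of_ge (I := L') hJ]
    have h2 : e L' * u (-x + y) * e L' = 0 := e_u_e L' _ fun h3 => h (by
      have : x - y = -(-x + y) := by ring
      rw [this]
      exact neg_mem h3)
    calc _ = e I * (e L' * u (-x + y) * e L') * e J := by simp only [mul_assoc]
      _ = 0 := by rw [h2, mul_zero, zero_mul]
  calc _ = u x * (e I * (u (-x) * u y) * e J) * u (-y) := by simp only [cosetProj, mul_assoc]
    _ = 0 := by rw [h1, mul_zero, zero_mul]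

theorem cosetProj_mul_of_le {x y : R} {I J : NonzeroIdeal R} (hIJ : I.1 ≤ J.1) (h : x - y ∈ J.1) :
    cosetProj x I * cosetProj y J = cosetProj x I := by
  rw [← cosetProj_eq h, cosetProj_mul_cosetProj_self]
  congr 1
  exact Subtype.ext (inf_eq_left.2 hIJ)

/-- The cosets x + I and y + J meet exactly when x - y ∈ I + J, and their intersection is then a
coset of I ∩ J. -/
theorem cosetProj_mul_cosetProj (x y : R) (I J : NonzeroIdeal R) :
    cosetProj x I * cosetProj y J = 0 ∨ ∃ z, z - x ∈ I.1 ∧ z - y ∈ J.1 ∧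
      cosetProj x I * cosetProj y J = cosetProj z (I.inf J) := by
  by_cases h : x - y ∈ I.1 ⊔ J.1
  · obtain ⟨i, hi, j, hj, hij⟩ := Submodule.mem_sup.1 h
    have hx : x - i - x ∈ I.1 := by simpa using hi
    have hy : x - i - y ∈ J.1 := by
      have : x - i - y = j := by rw [sub_right_comm, ← hij]; ring
      rwa [this]
    refine Or.inr ⟨x - i, hx, hy, ?_⟩
    rw [← cosetProj_eq hx, ← cosetProj_eq hy, cosetProj_mul_cosetProj_self]
  · exact Or.inl (cosetProj_mul_eq_zero _ le_sup_left le_sup_right h)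

/-- The element is zero or the projection belonging to a coset of a non-zero ideal. -/
def IsCosetProj (p : ToeplitzAlgebra R) : Prop := p = 0 ∨ ∃ x I, p = cosetProj x I

theorem isCosetProj_cosetProj (x : R) (I : NonzeroIdeal R) : IsCosetProj (cosetProj x I) :=
  Or.inr ⟨x, I, rfl⟩

theorem isCosetProj_e (I : NonzeroIdeal R) : IsCosetProj (e I) :=
  cosetProj_zero I ▸ isCosetProj_cosetProj 0 I

theorem isCosetProj_one : IsCosetProj (1 : ToeplitzAlgebra R) := e_top (R := R) ▸ isCosetProj_e _

namespace IsCosetProj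

variable {p q : ToeplitzAlgebra R}

theorem mul (hp : IsCosetProj p) (hq : IsCosetProj q) : IsCosetProj (p * q) := by
  rcases hp with rfl | ⟨x, I, rfl⟩
  · exact Or.inl (zero_mul _)
  rcases hq with rfl | ⟨y, J, rfl⟩
  · exact Or.inl (mul_zero _)
  rcases cosetProj_mul_cosetProj x y I J with h | ⟨z, -, -, h⟩
  · exact Or.inl h
  · exact Or.inr ⟨z, _, h⟩

theorem star_eq (hp : IsCosetProj p) : star p = p := by
  rcases hp with rfl | ⟨x, I, rfl⟩
  · exact star_zero _
  · exact star_cosetProj x I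

/-- The product is again zero or a coset projection, hence self-adjoint, and self-adjoint elements
with self-adjoint product commute. -/
theorem mul_comm (hp : IsCosetProj p) (hq : IsCosetProj q) : p * q = q * p := by
  rw [← (hp.mul hq).star_eq, star_mul, hp.star_eq, hq.star_eq]

end IsCosetProj

theorem cosetProj_mul_comm (x y : R) (I J : NonzeroIdeal R) :
    cosetProj x I * cosetProj y J = cosetProj y J * cosetProj x I :=
  (isCosetProj_cosetProj x I).mul_comm (isCosetProj_cosetProj y J)

/-! ### Commutation rules between isometries, translations and coset projections. -/

theorem s_mul_star_s (a : R⁰) : s a * star (s a) = e (NonzeroIdeal.top.smul a) := by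
  rw [← s_e_s, e_top, mul_one]

theorem s_mul_e (a : R⁰) (I : NonzeroIdeal R) : s a * e I = e (I.smul a) * s a := by
  rw [← s_e_s, mul_assoc, star_s_mul_s, mul_one]

theorem s_mul_cosetProj (a : R⁰) (x : R) (I : NonzeroIdeal R) :
    s a * cosetProj x I = cosetProj ((a : R) * x) (I.smul a) * s a := by
  simp only [cosetProj, mul_assoc]
  rw [← mul_assoc, s_mul_u, mul_assoc, ← mul_assoc (s a), s_mul_e, mul_assoc, s_mul_u, mul_neg]

theorem cosetProj_mul_star_s (a : R⁰) (x : R) (I : NonzeroIdeal R) :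
    cosetProj x I * star (s a) = star (s a) * cosetProj ((a : R) * x) (I.smul a) := by
  simpa [star_cosetProj] using congrArg star (s_mul_cosetProj a x I)

theorem u_mul_star_s (a : R⁰) (x : R) : u x * star (s a) = star (s a) * u ((a : R) * x) := by
  simpa [star_u] using congrArg star (s_mul_u a (-x))

theorem star_s_mul_star_s (a b : R⁰) : star (s a) * star (s b) = star (s (b * a)) := by
  rw [← star_mul, s_mul_s]

/-- Brings an adjoint to the left of an isometry at the cost of a projection, as required for the
normal form of monomials. It rests on s_a s_c = s_c s_a, so on the commutativity of `R`. -/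
theorem s_mul_star_s' (a c : R⁰) :
    s c * star (s a) = star (s a) * e ((NonzeroIdeal.top.smul a).smul c) * s c := by
  calc s c * star (s a) = star (s a) * (s a * s c) * star (s a) := by
        rw [← mul_assoc, star_s_mul_s, one_mul]
    _ = star (s a) * (s c * s a) * star (s a) := by rw [s_mul_s, s_mul_s, mul_comm]
    _ = star (s a) * (s c * (s a * star (s a))) := by simp only [mul_assoc]
    _ = _ := by rw [s_mul_star_s, s_mul_e, mul_assoc]

theorem IsCosetProj.exists_u_mul {p : ToeplitzAlgebra R} (hp : IsCosetProj p) (x : R) :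
    ∃ q, IsCosetProj q ∧ u x * p = q * u x := by
  rcases hp with rfl | ⟨y, I, rfl⟩
  · exact ⟨0, Or.inl rfl, by simp⟩
  · exact ⟨_, isCosetProj_cosetProj _ _, u_mul_cosetProj x y I⟩

theorem IsCosetProj.exists_s_mul {p : ToeplitzAlgebra R} (hp : IsCosetProj p) (a : R⁰) :
    ∃ q, IsCosetProj q ∧ s a * p = q * s a := by
  rcases hp with rfl | ⟨y, I, rfl⟩
  · exact ⟨0, Or.inl rfl, by simp⟩
  · exact ⟨_, isCosetProj_cosetProj _ _, s_mul_cosetProj a y I⟩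

/-- The range projection of s_a is that of aR, so only the intersection of y + I with aR matters. It
is empty or of the form a(r + J), and then s_a absorbs the factor a. This turns the monomials of
degree one into coset projections. -/
theorem IsCosetProj.star_s_mul_mul_s {p : ToeplitzAlgebra R} (hp : IsCosetProj p) (a : R⁰) :
    IsCosetProj (star (s a) * p * s a) := by
  rcases hp with rfl | ⟨y, I, rfl⟩
  · exact Or.inl (by simp)
  have h1 : star (s a) * cosetProj y I * s a =
      star (s a) * (cosetProj y I * cosetProj 0 (NonzeroIdeal.top.smul a)) * s a := by
    rw [cosetProj_zero, ← s_mul_star_s]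
    simp only [mul_assoc, star_s_mul_s, mul_one]
  rw [h1]
  rcases cosetProj_mul_cosetProj y 0 I (NonzeroIdeal.top.smul a) with h | ⟨z, -, hz, h⟩
  · exact Or.inl (by rw [h]; simp)
  rw [h]
  obtain ⟨r, -, hr⟩ := Ideal.mem_span_singleton_mul.1 hz
  rw [sub_zero] at hr
  -- The ideal of all w with aw ∈ I; it contains I, so it is non-zero.
  let J : NonzeroIdeal R := ⟨Submodule.comap (LinearMap.mulLeft R (a : R)) I.1, fun hJ => I.2
    (le_bot_iff.1 (le_trans (fun i hi => I.1.mul_mem_left _ hi) hJ.le))⟩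
  have hJ : I.inf (NonzeroIdeal.top.smul a) = J.smul a := by
    refine Subtype.ext (Ideal.ext fun t => ?_)
    change t ∈ I.1 ⊓ Ideal.span {(a : R)} * ⊤ ↔ t ∈ Ideal.span {(a : R)} * J.1
    rw [Submodule.mem_inf, Ideal.mem_span_singleton_mul, Ideal.mem_span_singleton_mul]
    constructor
    · rintro ⟨ht, w, -, rfl⟩
      exact ⟨w, ht, rfl⟩
    · rintro ⟨w, hw, rfl⟩
      exact ⟨hw, w, trivial, rfl⟩
  rw [hJ, ← hr, mul_assoc, ← s_mul_cosetProj, ← mul_assoc, star_s_mul_s, one_mul]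
  exact isCosetProj_cosetProj _ _

/-! ### Monomials -/

/-- The elements of the form `s_a^* p u^z s_b`, where `p` is zero or a coset projection. -/
def monomials (R : Type*) [CommRing R] [IsDomain R] : Set (ToeplitzAlgebra R) :=
  {t | ∃ (a b : R⁰) (z : R) (p : ToeplitzAlgebra R), IsCosetProj p ∧
    t = star (s a) * p * u z * s b}

theorem one_mem_monomials : (1 : ToeplitzAlgebra R) ∈ monomials R :=
  ⟨1, 1, 0, 1, isCosetProj_one, by simp [s_one, u_zero]⟩

theorem u_mul_mem_monomials (x : R) {t : ToeplitzAlgebra R} (ht : t ∈ monomials R) :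
    u x * t ∈ monomials R := by
  obtain ⟨a, b, z, p, hp, rfl⟩ := ht
  obtain ⟨q, hq, h⟩ := hp.exists_u_mul ((a : R) * x)
  refine ⟨a, b, (a : R) * x + z, q, hq, ?_⟩
  calc _ = u x * star (s a) * p * u z * s b := by simp only [mul_assoc]
    _ = star (s a) * (u ((a : R) * x) * p) * u z * s b := by rw [u_mul_star_s]; simp only [mul_assoc]
    _ = star (s a) * q * (u ((a : R) * x) * u z) * s b := by rw [h]; simp only [mul_assoc]
    _ = _ := by rw [u_mul_u]

theorem e_mul_mem_monomials (I : NonzeroIdeal R) {t : ToeplitzAlgebra R} (ht : t ∈ monomials R) :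
    e I * t ∈ monomials R := by
  obtain ⟨a, b, z, p, hp, rfl⟩ := ht
  refine ⟨a, b, z, _, (isCosetProj_cosetProj ((a : R) * 0) (I.smul a)).mul hp, ?_⟩
  calc _ = e I * star (s a) * p * u z * s b := by simp only [mul_assoc]
    _ = _ := by rw [← cosetProj_zero, cosetProj_mul_star_s]; simp only [mul_assoc]

theorem star_s_mul_mem_monomials (c : R⁰) {t : ToeplitzAlgebra R} (ht : t ∈ monomials R) :
    star (s c) * t ∈ monomials R := by
  obtain ⟨a, b, z, p, hp, rfl⟩ := ht
  refine ⟨a * c, b, z, p, hp, ?_⟩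
  rw [← star_s_mul_star_s]
  simp only [mul_assoc]

theorem s_mul_mem_monomials (c : R⁰) {t : ToeplitzAlgebra R} (ht : t ∈ monomials R) :
    s c * t ∈ monomials R := by
  obtain ⟨a, b, z, p, hp, rfl⟩ := ht
  obtain ⟨q, hq, h⟩ := hp.exists_s_mul c
  refine ⟨a, c * b, (c : R) * z, _, (isCosetProj_e ((NonzeroIdeal.top.smul a).smul c)).mul hq, ?_⟩
  calc _ = s c * star (s a) * p * u z * s b := by simp only [mul_assoc]
    _ = star (s a) * e ((NonzeroIdeal.top.smul a).smul c) * (s c * p) * u z * s b := by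
      rw [s_mul_star_s']; simp only [mul_assoc]
    _ = star (s a) * e ((NonzeroIdeal.top.smul a).smul c) * q * (s c * u z) * s b := by
      rw [h]; simp only [mul_assoc]
    _ = star (s a) * e ((NonzeroIdeal.top.smul a).smul c) * q * u ((c : R) * z) * (s c * s b) := by
      rw [s_mul_u]; simp only [mul_assoc]
    _ = _ := by rw [s_mul_s]; simp only [mul_assoc]

theorem mk_letter_mul_mem_monomials (l : Generator R × Bool) {t : ToeplitzAlgebra R}
    (ht : t ∈ monomials R) : mk (FreeStarAlgebra.letter l) * t ∈ monomials R := by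
  obtain ⟨g, b⟩ := l
  have hstar : mk (FreeStarAlgebra.letter (g, true)) = star (mk (FreeStarAlgebra.gen g)) := by
    rw [star_mk]
    exact congrArg mk (FreeStarAlgebra.star_letter (g, false)).symm
  cases b with
  | false =>
    cases g with
    | u x => exact u_mul_mem_monomials x ht
    | s a => exact s_mul_mem_monomials a ht
    | e I => exact e_mul_mem_monomials I ht
  | true =>
    rw [hstar]
    cases g with
    | u x =>
      change star (u x) * t ∈ _
      rw [star_u]
      exact u_mul_mem_monomials _ ht
    | s a => exact star_s_mul_mem_monomials a ht
    | e I =>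
      change star (e I) * t ∈ _
      rw [star_e]
      exact e_mul_mem_monomials I ht

theorem mk_mem_span_monomials (y : FreeToeplitz R) : mk y ∈ Submodule.span ℂ (monomials R) := by
  -- Invariance of the span under left multiplication passes through products in the free algebra,
  -- so only single letters have to be multiplied with monomials.
  suffices h : ∀ m ∈ Submodule.span ℂ (monomials R), mk y * m ∈ Submodule.span ℂ (monomials R) by
    simpa using h 1 (Submodule.subset_span one_mem_monomials)
  induction y using FreeStarAlgebra.induction with
  | scalar c =>
    intro m hm
    rw [mk_algebraMap, ← Algebra.smul_def]
    exact Submodule.smul_mem _ _ hm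
  | letter l =>
    intro m hm
    induction hm using Submodule.span_induction with
    | mem t ht => exact Submodule.subset_span (mk_letter_mul_mem_monomials l ht)
    | zero => simp
    | add x y _ _ hx hy => rw [mul_add]; exact add_mem hx hy
    | smul c x _ hx => rw [mul_smul_comm]; exact Submodule.smul_mem _ _ hx
  | mul a b ha hb =>
    intro m hm
    rw [map_mul, mul_assoc]
    exact ha _ (hb _ hm)
  | add a b ha hb =>
    intro m hm
    rw [map_add, add_mul]
    exact add_mem (ha _ hm) (hb _ hm)

/-- A monomial `s_a^* p u^z s_b` is compressed to zero by the projection of a coset which is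
disjoint from its image under `r ↦ (b r + z) / a`. -/
theorem cosetProj_mul_monomial_mul_cosetProj {a b : R⁰} {z : R} {p : ToeplitzAlgebra R}
    (hp : IsCosetProj p) {x : R} {I : NonzeroIdeal R}
    (h : ((b : R) - a) * x + z ∉ I.1) :
    cosetProj x I * (star (s a) * p * u z * s b) * cosetProj x I = 0 := by
  -- Moved inside the monomial, the two outer projections become those of ax + aI and bx + z + bI.
  -- Both lie in cosets of I, and these are distinct by hypothesis.
  have h0 : cosetProj ((a : R) * x) (I.smul a) * cosetProj (z + b * x) (I.smul b) = 0 := by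
    refine cosetProj_mul_eq_zero I.1 Ideal.mul_le_right Ideal.mul_le_right fun h1 => h ?_
    have : ((b : R) - a) * x + z = -(a * x - (z + b * x)) := by ring
    rw [this]
    exact neg_mem h1
  calc _ = (cosetProj x I * star (s a)) * p * u z * (s b * cosetProj x I) := by
        simp only [mul_assoc]
    _ = star (s a) * cosetProj ((a : R) * x) (I.smul a) * p *
          (u z * cosetProj ((b : R) * x) (I.smul b)) * s b := by
        rw [cosetProj_mul_star_s, s_mul_cosetProj]; simp only [mul_assoc]
    _ = star (s a) * cosetProj ((a : R) * x) (I.smul a) * (p *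
          cosetProj (z + b * x) (I.smul b)) * u z * s b := by
        rw [u_mul_cosetProj]; simp only [mul_assoc]
    _ = star (s a) * (cosetProj ((a : R) * x) (I.smul a) * cosetProj (z + b * x) (I.smul b)) *
          p * u z * s b := by
        rw [hp.mul_comm (isCosetProj_cosetProj _ _)]; simp only [mul_assoc]
    _ = 0 := by rw [h0]; simp

end ToeplitzAlgebra

/-! ### Characters, states and representations of C*-algebras -/

/-- In a commutative C*-algebra every element is normal, so its norm is its spectral radius, and
every spectral value is the value of a character. -/
theorem exists_character_norm_eq {S : Type*} [CommCStarAlgebra S] [Nontrivial S] (b : S) :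
    ∃ χ : WeakDual.characterSpace ℂ S, ‖χ b‖ = ‖b‖ := by
  obtain ⟨z, hz, hzb⟩ := spectrum.exists_nnnorm_eq_spectralRadius b
  obtain ⟨χ, hχ⟩ := WeakDual.CharacterSpace.mem_spectrum_iff_exists.1 hz
  refine ⟨χ, ?_⟩
  rw [IsStarNormal.spectralRadius_eq_nnnorm] at hzb
  rw [hχ]
  exact congrArg NNReal.toReal (ENNReal.coe_injective hzb)

/-- On a family of commuting self-adjoint elements, there is a character attaining the norm at a
given element of the C*-algebra generated by the family. -/
theorem exists_subalgebra_character {A : Type*} [CStarAlgebra A] [Nontrivial A] {s : Set A}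
    (hcomm : ∀ x ∈ s, ∀ y ∈ s, x * y = y * x) (hstar : ∀ x ∈ s, star x = x) :
    ∃ S : StarSubalgebra ℂ A, s ⊆ S ∧ ∀ d : S, ∃ χ : S →ₐ[ℂ] ℂ,
      (∀ x, ‖χ x‖ ≤ ‖x‖) ∧ ‖χ d‖ = ‖d‖ := by
  have hc : IsMulCommutative (StarAlgebra.adjoin ℂ s) :=
    StarAlgebra.isMulCommutative_adjoin ℂ hcomm
      fun a ha b hb => by rw [hstar b hb]; exact hcomm a ha b hb
  let S := (StarAlgebra.adjoin ℂ s).topologicalClosure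
  have hclosed : IsClosed (S : Set A) := (StarAlgebra.adjoin ℂ s).isClosed_topologicalClosure
  let R0 : CommRing S := StarSubalgebra.commRingTopologicalClosure (StarAlgebra.adjoin ℂ s)
    fun x y => hc.is_comm.comm x y
  let _ : CommCStarAlgebra S :=
    { (inferInstance : CStarAlgebra S) with mul_comm := R0.mul_comm }
  refine ⟨S, (StarAlgebra.subset_adjoin ℂ s).trans
    (StarAlgebra.adjoin ℂ s).le_topologicalClosure, fun d => ?_⟩
  obtain ⟨χ, hχ⟩ := exists_character_norm_eq d
  exact ⟨WeakDual.CharacterSpace.toAlgHom χ, fun x => AlgHom.norm_apply_le_self χ x, hχ⟩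

open ComplexOrder in
/-- A unital contractive functional on a C*-algebra is positive. -/
theorem nonneg_of_norm_le_of_map_one {A : Type*} [CStarAlgebra A] [PartialOrder A]
    [StarOrderedRing A] (g : A →L[ℂ] ℂ) (hg : ∀ x, ‖g x‖ ≤ ‖x‖) (h1 : g 1 = 1) {a : A}
    (ha : 0 ≤ a) : 0 ≤ g a := by
  have hsa : IsSelfAdjoint a := .of_nonneg ha
  have hscal : ∀ c : ℂ, g (algebraMap ℂ A c) = c := fun c => by
    rw [Algebra.algebraMap_eq_smul_one, map_smul, h1, smul_eq_mul, mul_one]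
  have hone : ‖(1 : A)‖ ≤ 1 := by
    have := CStarRing.norm_star_mul_self (x := (1 : A))
    rw [star_one, one_mul] at this
    nlinarith [sq_nonneg (‖(1 : A)‖ - 1)]
  have him : (g a).im = 0 := by
    -- For self-adjoint a, ‖a + it‖² ≤ ‖a‖² + t², whereas |g(a) + it|² ≥ (Im g(a) + t)². The t²
    -- cancels, and a bound on a linear function of all real t forces Im g(a) = 0.
    have key : ∀ t : ℝ, 2 * t * (g a).im ≤ ‖a‖ ^ 2 := by
      intro t
      have e1 : ‖a + algebraMap ℂ A (t * Complex.I)‖ ^ 2 ≤ ‖a‖ ^ 2 + t ^ 2 := by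
        rw [sq, ← CStarRing.norm_star_mul_self, star_add, hsa.star_eq, ← algebraMap_star_comm]
        have : (a + algebraMap ℂ A (star (t * Complex.I))) * (a + algebraMap ℂ A (t * Complex.I))
            = a * a + algebraMap ℂ A ((t : ℂ) ^ 2) := by
          have h2 : star ((t : ℂ) * Complex.I) = -(t * Complex.I) := by simp
          have h3 : ((t : ℂ) ^ 2) = -(t * Complex.I * (t * Complex.I)) := by
            linear_combination (t : ℂ) ^ 2 * Complex.I_mul_I
          rw [h2, h3, map_neg, map_neg, map_mul _ (_ * _) (_ * _), add_mul, mul_add, mul_add,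
            neg_mul, Algebra.commutes (t * Complex.I) a]
          noncomm_ring
        rw [this]
        refine (norm_add_le _ _).trans (add_le_add ?_ ?_)
        · rw [sq]; exact norm_mul_le _ _
        · rw [Algebra.algebraMap_eq_smul_one]
          refine (norm_smul_le _ _).trans ?_
          rw [norm_pow, Complex.norm_real, Real.norm_eq_abs, sq_abs]
          exact mul_le_of_le_one_right (sq_nonneg t) hone
      have e2 : ‖g a + t * Complex.I‖ ^ 2 = (g a).re ^ 2 + ((g a).im + t) ^ 2 := by
        rw [← Complex.normSq_eq_norm_sq, Complex.normSq_apply]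
        simp
        ring
      have e3 := hg (a + algebraMap ℂ A (t * Complex.I))
      rw [map_add, hscal] at e3
      have e4 := pow_le_pow_left₀ (norm_nonneg _) e3 2
      nlinarith [sq_nonneg (g a).re, sq_nonneg (g a).im]
    by_contra hne
    have := key ((‖a‖ ^ 2 + 1) / (2 * (g a).im))
    have h3 : 2 * ((‖a‖ ^ 2 + 1) / (2 * (g a).im)) * (g a).im = ‖a‖ ^ 2 + 1 := by field_simp
    linarith
  -- Positivity of a gives ‖‖a‖ - a‖ ≤ ‖a‖, so g(a) lies within ‖a‖ of ‖a‖.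
  have hre : 0 ≤ (g a).re := by
    have e1 : ‖algebraMap ℂ A ‖a‖ - a‖ ≤ ‖a‖ := by
      have h0 : a ≤ algebraMap ℝ A ‖a‖ := hsa.le_algebraMap_norm_self
      have h0' : algebraMap ℂ A ‖a‖ = algebraMap ℝ A ‖a‖ := by
        rw [IsScalarTower.algebraMap_apply ℝ ℂ A]; rfl
      rw [h0']
      refine (CStarAlgebra.norm_le_norm_of_nonneg_of_le (sub_nonneg.2 h0)
        (sub_le_self _ ha)).trans ?_
      rw [Algebra.algebraMap_eq_smul_one]
      refine (norm_smul_le _ _).trans ?_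
      rw [norm_norm]
      exact mul_le_of_le_one_right (norm_nonneg a) hone
    have e3 := (hg _).trans e1
    rw [map_sub, hscal] at e3
    have e4 := (Complex.re_le_norm _).trans e3
    simp only [Complex.sub_re, Complex.ofReal_re] at e4
    linarith
  exact Complex.nonneg_iff.2 ⟨hre, him.symm⟩

open ComplexOrder in
/-- Every non-zero element of a C*-algebra is non-zero in some representation on a Hilbert
space. -/
theorem exists_representation_ne_zero.{v} {A : Type v} [CStarAlgebra A] {y : A} (hy : y ≠ 0) :
    ∃ (H : Type v) (_ : NormedAddCommGroup H) (_ : InnerProductSpace ℂ H) (_ : CompleteSpace H)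
      (π : A →⋆ₐ[ℂ] (H →L[ℂ] H)), π y ≠ 0 := by
  let _ : PartialOrder A := CStarAlgebra.spectralOrder A
  have _ : StarOrderedRing A := CStarAlgebra.spectralOrderedRing A
  have _ : Nontrivial A := ⟨y, 0, hy⟩
  obtain ⟨S, hS, hχ⟩ := exists_subalgebra_character (s := {star y * y})
    (by rintro x rfl z rfl; rfl) (by rintro x rfl; simp)
  obtain ⟨χ, hχ1, hχ2⟩ := hχ ⟨star y * y, hS rfl⟩
  -- The Hahn–Banach extension has norm at most one and takes the value one at 1, so it is a state.
  obtain ⟨g, hg, hgn⟩ := exists_extension_norm_eq S.toSubalgebra.toSubmodule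
    (LinearMap.mkContinuous (χ.toLinearMap : S.toSubalgebra.toSubmodule →ₗ[ℂ] ℂ) 1
      fun x => by rw [one_mul]; exact hχ1 x)
  have hgn1 : ∀ x, ‖g x‖ ≤ ‖x‖ := by
    intro x
    have h1 : ‖g‖ ≤ 1 := by
      rw [hgn]
      exact LinearMap.mkContinuous_norm_le _ zero_le_one _
    exact (g.le_opNorm x).trans (mul_le_of_le_one_left (norm_nonneg _) h1)
  have hg1 : g 1 = 1 := (hg ⟨1, one_mem S⟩).trans (map_one χ)
  have hgy : g (star y * y) ≠ 0 := by
    have h1 : g (star y * y) = χ ⟨star y * y, hS rfl⟩ := hg ⟨star y * y, hS rfl⟩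
    rw [h1, ← norm_ne_zero_iff, hχ2]
    change ‖star y * y‖ ≠ 0
    rw [CStarRing.norm_star_mul_self]
    simpa using hy
  let f : A →ₚ[ℂ] ℂ := PositiveLinearMap.mk₀ g.toLinearMap
    fun x hx => nonneg_of_norm_le_of_map_one g hgn1 hg1 hx
  refine ⟨f.GNS, inferInstance, inferInstance, inferInstance, f.gnsStarAlgHom, fun h => hgy ?_⟩
  -- The image of the cyclic vector 1 under π(y) has squared norm g(y^* y), which is non-zero.
  have h1 : f.gnsNonUnitalStarAlgHom y (f.toPreGNS 1 : f.GNS) = 0 := by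
    have : f.gnsNonUnitalStarAlgHom y = 0 := h
    rw [this]; rfl
  rw [PositiveLinearMap.gnsNonUnitalStarAlgHom_apply_coe, ← norm_eq_zero,
    UniformSpace.Completion.norm_coe] at h1
  have h2 := f.preGNS_norm_sq (f.leftMulMapPreGNS y (f.toPreGNS 1))
  rw [h1] at h2
  have h3 : f.ofPreGNS (f.leftMulMapPreGNS y (f.toPreGNS 1)) = y := mul_one y
  rw [h3] at h2
  have h4 : f (star y * y) = g (star y * y) := rfl
  rw [← h4, ← h2]
  simp

/-! ### Operators on spaces of square summable families -/

/-- The Hilbert space of square summable families in `H` indexed by `X`. -/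
abbrev L2 (X H : Type*) [NormedAddCommGroup H] : Type _ := lp (fun _ : X => H) 2

namespace L2

open Function

variable {X Y Z H : Type*} [NormedAddCommGroup H] [InnerProductSpace ℂ H]

open Classical in
/-- The family whose only entry is `v` at `x`. -/
def single {X H : Type*} [NormedAddCommGroup H] (x : X) (v : H) : L2 X H := lp.single 2 x v

open Classical in
theorem single_apply_self {X H : Type*} [NormedAddCommGroup H] (x : X) (v : H) :
    single x v x = v :=
  lp.single_apply_self _ _ _

open Classical in
theorem single_apply_ne {X H : Type*} [NormedAddCommGroup H] {x y : X} (v : H) (h : y ≠ x) :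
    single x v y = 0 :=
  lp.single_apply_ne _ _ _ h

open Classical in
theorem norm_single {X H : Type*} [NormedAddCommGroup H] (x : X) (v : H) :
    ‖single x v‖ = ‖v‖ :=
  lp.norm_single (E := fun _ : X => H) (p := 2) (by norm_num) x v

open Classical in
theorem single_zero {X H : Type*} [NormedAddCommGroup H] (x : X) :
    (single x 0 : L2 X H) = 0 :=
  lp.single_zero _ _

open Classical in
theorem norm_sum_single {X H : Type*} [NormedAddCommGroup H] (F : Finset X) (v : H) :
    ‖(∑ x ∈ F, single x v : L2 X H)‖ ^ 2 = F.card * ‖v‖ ^ 2 := by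
  have h := lp.norm_sum_single (E := fun _ : X => H) (p := 2) (by norm_num) (fun _ => v) F
  simp only [ENNReal.toReal_ofNat, Real.rpow_two, Finset.sum_const, nsmul_eq_mul] at h
  exact h

/-- Extension by zero along an injective map. -/
def extend {j : Y → X} (hj : Injective j) : L2 Y H →L[ℂ] L2 X H :=
  LinearMap.mkContinuous
    { toFun := fun ξ => ⟨Function.extend j ξ 0, memℓp_gen (by
        refine (hj.summable_iff fun x hx => ?_).1 ?_
        · rw [extend_apply' _ _ _ hx]; simp
        · have := (lp.memℓp ξ).summable (by simp)
          simpa only [comp_def, hj.extend_apply] using this)⟩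
      map_add' := fun ξ η => by
        refine Subtype.ext (funext fun x => ?_)
        change Function.extend j (⇑(ξ + η)) 0 x = Function.extend j ξ 0 x + Function.extend j η 0 x
        by_cases hx : ∃ y, j y = x
        · obtain ⟨y, rfl⟩ := hx
          simp only [hj.extend_apply]
          rfl
        · simp only [extend_apply' _ _ _ hx, Pi.zero_apply, add_zero]
      map_smul' := fun c ξ => by
        refine Subtype.ext (funext fun x => ?_)
        change Function.extend j (⇑(c • ξ)) 0 x = c • Function.extend j ξ 0 x
        by_cases hx : ∃ y, j y = x
        · obtain ⟨y, rfl⟩ := hx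
          simp [hj.extend_apply]
        · simp [extend_apply' _ _ _ hx] } 1 (fun ξ => by
    rw [one_mul]
    refine lp.norm_le_of_tsum_le (by simp) (norm_nonneg _) ?_
    rw [lp.norm_rpow_eq_tsum (by simp)]
    refine (hj.tsum_eq (fun x hx => ?_)).symm.le.trans_eq ?_
    · by_contra h
      refine hx ?_
      change ‖Function.extend j ξ 0 x‖ ^ _ = 0
      rw [extend_apply' _ _ _ h]
      simp
    · refine tsum_congr fun y => ?_
      change ‖Function.extend j ξ 0 (j y)‖ ^ _ = _
      rw [hj.extend_apply])

theorem extend_apply {j : Y → X} (hj : Injective j) (ξ : L2 Y H) (y : Y) :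
    extend hj ξ (j y) = ξ y :=
  hj.extend_apply _ _ y

theorem extend_apply_of_notMem {j : Y → X} (hj : Injective j) (ξ : L2 Y H) {x : X}
    (hx : ∀ y, j y ≠ x) : extend hj ξ x = 0 :=
  Function.extend_apply' _ _ x fun ⟨y, hy⟩ => hx y hy

theorem extend_single {j : Y → X} (hj : Injective j) (y : Y) (h : H) :
    extend hj (single y h : L2 Y H) = single (j y) h := by
  refine lp.ext (funext fun x => ?_)
  by_cases hx : ∃ y', j y' = x
  · obtain ⟨y', rfl⟩ := hx
    rw [extend_apply]
    by_cases hy : y' = y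
    · subst hy; rw [single_apply_self, single_apply_self]
    · rw [single_apply_ne _ hy, single_apply_ne _ (fun h => hy (hj h))]
  · push Not at hx
    rw [extend_apply_of_notMem hj _ hx, single_apply_ne _ (hx y).symm]

open Classical in
theorem inner_single (x : X) (v : H) (ξ : L2 X H) :
    inner ℂ (single x v : L2 X H) ξ = inner ℂ v (ξ x : H) :=
  lp.inner_single_left (G := fun _ : X => H) x v ξ

open Classical in
theorem ext_single {T S : L2 X H →L[ℂ] L2 Y H}
    (h : ∀ x v, T (single x v) = S (single x v)) : T = S :=
  lp.ext_continuousLinearMap (by simp) fun x => ContinuousLinearMap.ext fun v => h x v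

theorem extend_congr {j k : Y → X} (hj : Injective j) (hk : Injective k) (h : ∀ y, j y = k y) :
    (extend hj : L2 Y H →L[ℂ] L2 X H) = extend hk := by
  obtain rfl := funext h
  rfl

/-- The application of a bounded operator in every coordinate. -/
def diag (T : H →L[ℂ] H) : L2 X H →L[ℂ] L2 X H :=
  LinearMap.mkContinuous
    { toFun := fun ξ => ⟨fun x => T (ξ x), ((lp.memℓp ξ).norm.const_mul ‖T‖).mono fun x => by
        exact (T.le_opNorm _).trans_eq (by simp)⟩
      map_add' := fun ξ η => Subtype.ext (funext fun x => map_add T _ _)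
      map_smul' := fun c ξ => Subtype.ext (funext fun x => map_smul T c _) } ‖T‖ (fun ξ => by
    have h : ‖((‖T‖ : ℝ) : ℂ) • ξ‖ = ‖T‖ * ‖ξ‖ := by rw [norm_smul, Complex.norm_real, norm_norm]
    refine le_of_le_of_eq (lp.norm_mono (by simp) fun x => ?_) h
    refine (T.le_opNorm (ξ x)).trans_eq ?_
    change _ = ‖((‖T‖ : ℝ) : ℂ) • ξ x‖
    rw [norm_smul, Complex.norm_real, norm_norm])

theorem diag_apply (T : H →L[ℂ] H) (ξ : L2 X H) (x : X) : diag T ξ x = T (ξ x) := rfl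

theorem diag_single (T : H →L[ℂ] H) (x : X) (v : H) :
    diag T (single x v : L2 X H) = single x (T v) := by
  refine lp.ext (funext fun y => ?_)
  rw [diag_apply]
  by_cases hy : y = x
  · subst hy; rw [single_apply_self, single_apply_self]
  · rw [single_apply_ne _ hy, single_apply_ne _ hy, map_zero]

theorem extend_mul_extend {j k : X → X} (hj : Injective j) (hk : Injective k) :
    (extend hj * extend hk : L2 X H →L[ℂ] L2 X H) = extend (hj.comp hk) := by
  refine ext_single fun x v => ?_
  change extend hj (extend hk _) = _
  rw [extend_single, extend_single, extend_single]
  rfl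

/-- The operator which applies `T` in every coordinate and permutes the coordinates. -/
def permute (σ : Equiv.Perm X) (T : H →L[ℂ] H) : L2 X H →L[ℂ] L2 X H :=
  extend σ.injective * diag T

theorem permute_apply (σ : Equiv.Perm X) (T : H →L[ℂ] H) (ξ : L2 X H) (x : X) :
    permute σ T ξ x = T (ξ (σ⁻¹ x)) := by
  have h := extend_apply σ.injective (diag T ξ) (σ⁻¹ x)
  rw [Equiv.Perm.inv_def, Equiv.apply_symm_apply] at h
  exact h

theorem permute_single (σ : Equiv.Perm X) (T : H →L[ℂ] H) (x : X) (v : H) :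
    permute σ T (single x v : L2 X H) = single (σ x) (T v) := by
  change extend σ.injective (diag T _) = _
  rw [diag_single, extend_single]

theorem permute_mul_permute (σ τ : Equiv.Perm X) (T S : H →L[ℂ] H) :
    permute σ T * permute τ S = permute (σ * τ) (T * S) := by
  refine ext_single fun x v => ?_
  change permute σ T (permute τ S _) = _
  rw [permute_single, permute_single, permute_single]
  rfl

theorem permute_one : (permute 1 1 : L2 X H →L[ℂ] L2 X H) = 1 := by
  exact ext_single fun x v => permute_single 1 1 x v

theorem permute_zero (σ : Equiv.Perm X) : (permute σ 0 : L2 X H →L[ℂ] L2 X H) = 0 := by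
  refine ext_single fun x v => ?_
  rw [permute_single]
  change single (σ x) 0 = _
  rw [single_zero]
  rfl

variable [CompleteSpace H]

theorem adjoint_extend_apply {j : Y → X} (hj : Injective j) (ξ : L2 X H) (y : Y) :
    ContinuousLinearMap.adjoint (extend hj : L2 Y H →L[ℂ] L2 X H) ξ y = ξ (j y) := by
  refine ext_inner_left ℂ fun v => ?_
  calc inner ℂ v (ContinuousLinearMap.adjoint (extend hj : L2 Y H →L[ℂ] L2 X H) ξ y : H)
      = inner ℂ (single y v : L2 Y H)
        (ContinuousLinearMap.adjoint (extend hj : L2 Y H →L[ℂ] L2 X H) ξ) :=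
          (inner_single _ _ _).symm
    _ = inner ℂ v (ξ (j y)) := by
      rw [ContinuousLinearMap.adjoint_inner_right, extend_single]
      exact inner_single _ _ _

/-- Restriction to a set, viewed as a projection. -/
def proj (s : Set X) : L2 X H →L[ℂ] L2 X H :=
  extend (Subtype.val_injective (p := (· ∈ s))) ∘L ContinuousLinearMap.adjoint
    (extend (Subtype.val_injective (p := (· ∈ s))))

theorem proj_apply_of_mem {s : Set X} {x : X} (hx : x ∈ s) (ξ : L2 X H) :
    proj s ξ x = ξ x := by
  have h := extend_apply (Subtype.val_injective (p := (· ∈ s))) (ContinuousLinearMap.adjoint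
    (extend (Subtype.val_injective (p := (· ∈ s)))) ξ) ⟨x, hx⟩
  rw [adjoint_extend_apply] at h
  exact h

theorem proj_apply_of_notMem {s : Set X} {x : X} (hx : x ∉ s) (ξ : L2 X H) :
    proj s ξ x = 0 :=
  extend_apply_of_notMem Subtype.val_injective _ fun y hy => hx (hy ▸ y.2)

theorem star_proj (s : Set X) : star (proj s : L2 X H →L[ℂ] L2 X H) = proj s := by
  rw [ContinuousLinearMap.star_eq_adjoint, proj, ContinuousLinearMap.adjoint_comp,
    ContinuousLinearMap.adjoint_adjoint]

theorem proj_mul_proj (s t : Set X) :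
    (proj s * proj t : L2 X H →L[ℂ] L2 X H) = proj (s ∩ t) := by
  refine ContinuousLinearMap.ext fun ξ => lp.ext (funext fun x => ?_)
  change proj s (proj t ξ) x = _
  by_cases hs : x ∈ s
  · rw [proj_apply_of_mem hs]
    by_cases ht : x ∈ t
    · rw [proj_apply_of_mem ht, proj_apply_of_mem (s := s ∩ t) ⟨hs, ht⟩]
    · rw [proj_apply_of_notMem ht, proj_apply_of_notMem fun h => ht h.2]
  · rw [proj_apply_of_notMem hs, proj_apply_of_notMem fun h => hs h.1]

theorem star_extend_apply {j : X → X} (hj : Injective j) (ξ : L2 X H) (x : X) :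
    (star (extend hj : L2 X H →L[ℂ] L2 X H)) ξ x = ξ (j x) := by
  rw [ContinuousLinearMap.star_eq_adjoint, adjoint_extend_apply]

theorem star_extend_mul_extend {j : X → X} (hj : Injective j) :
    star (extend hj : L2 X H →L[ℂ] L2 X H) * extend hj = 1 := by
  refine ContinuousLinearMap.ext fun ξ => lp.ext (funext fun x => ?_)
  change star (extend hj : L2 X H →L[ℂ] L2 X H) (extend hj ξ) x = ξ x
  rw [star_extend_apply, extend_apply]

theorem extend_mul_proj_mul_star_extend {j : X → X} (hj : Injective j) (s : Set X) :
    extend hj * proj s * star (extend hj : L2 X H →L[ℂ] L2 X H) = proj (j '' s) := by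
  refine ContinuousLinearMap.ext fun ξ => lp.ext (funext fun x => ?_)
  change extend hj (proj s (star (extend hj : L2 X H →L[ℂ] L2 X H) ξ)) x = _
  by_cases hx : ∃ y, j y = x
  · obtain ⟨y, rfl⟩ := hx
    rw [extend_apply]
    by_cases hy : y ∈ s
    · rw [proj_apply_of_mem hy, proj_apply_of_mem (Set.mem_image_of_mem j hy), star_extend_apply]
    · rw [proj_apply_of_notMem hy, proj_apply_of_notMem (by rwa [hj.mem_set_image])]
  · push Not at hx
    rw [extend_apply_of_notMem hj _ hx, proj_apply_of_notMem]
    rintro ⟨y, -, hy⟩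
    exact hx y hy

theorem extend_mul_proj {j : X → X} (hj : Injective j) (s : Set X) :
    (extend hj * proj s : L2 X H →L[ℂ] L2 X H) = proj (j '' s) * extend hj := by
  rw [← extend_mul_proj_mul_star_extend hj, mul_assoc, star_extend_mul_extend, mul_one]

theorem proj_univ : (proj Set.univ : L2 X H →L[ℂ] L2 X H) = 1 :=
  ContinuousLinearMap.ext fun ξ => lp.ext (funext fun x => proj_apply_of_mem (Set.mem_univ x) ξ)

theorem proj_empty : (proj ∅ : L2 X H →L[ℂ] L2 X H) = 0 :=
  ContinuousLinearMap.ext fun ξ => lp.ext (funext fun x => proj_apply_of_notMem (by simp) ξ)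

theorem adjoint_diag_apply (T : H →L[ℂ] H) (ξ : L2 X H) (x : X) :
    ContinuousLinearMap.adjoint (diag T : L2 X H →L[ℂ] L2 X H) ξ x =
      ContinuousLinearMap.adjoint T (ξ x) := by
  refine ext_inner_left ℂ fun v => ?_
  calc inner ℂ v (ContinuousLinearMap.adjoint (diag T : L2 X H →L[ℂ] L2 X H) ξ x : H)
      = inner ℂ (single x v : L2 X H)
        (ContinuousLinearMap.adjoint (diag T : L2 X H →L[ℂ] L2 X H) ξ) :=
          (inner_single _ _ _).symm
    _ = inner ℂ v (ContinuousLinearMap.adjoint T (ξ x)) := by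
      rw [ContinuousLinearMap.adjoint_inner_right, diag_single,
        ContinuousLinearMap.adjoint_inner_right]
      exact inner_single _ _ _

theorem star_permute (σ : Equiv.Perm X) (T : H →L[ℂ] H) :
    star (permute σ T) = permute σ⁻¹ (star T) := by
  refine ContinuousLinearMap.ext fun ξ => lp.ext (funext fun x => ?_)
  rw [permute_apply, permute, star_mul, inv_inv]
  change star (diag T : L2 X H →L[ℂ] L2 X H)
    (star (extend σ.injective : L2 X H →L[ℂ] L2 X H) ξ) x = _
  rw [ContinuousLinearMap.star_eq_adjoint, adjoint_diag_apply, star_extend_apply]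
  rfl

end L2

namespace ToeplitzAlgebra

variable {R : Type*} [CommRing R] [IsDomain R]

/-! ### The representation on families indexed by elements and ideals -/

namespace IdealRep

/-- The translation `(r, C) ↦ (x + r, C)`. -/
def translate {R : Type*} [CommRing R] (x : R) : R × NonzeroIdeal R → R × NonzeroIdeal R := fun q => (x + q.1, q.2)

/-- The map `(r, C) ↦ (a r, a C)`. -/
def scale (a : R⁰) : R × NonzeroIdeal R → R × NonzeroIdeal R := fun q => (a * q.1, q.2.smul a)

theorem translate_injective {R : Type*} [CommRing R] (x : R) : Function.Injective (translate x) := fun _ _ h =>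
  Prod.ext (add_left_cancel (Prod.ext_iff.1 h).1) (Prod.ext_iff.1 h).2

theorem smul_le_smul_iff (a : R⁰) (I J : NonzeroIdeal R) :
    (I.smul a).1 ≤ (J.smul a).1 ↔ I.1 ≤ J.1 := by
  have ha : (a : R) ≠ 0 := nonZeroDivisors.coe_ne_zero a
  refine ⟨fun h x hx => ?_, fun h => Ideal.mul_mono_right h⟩
  have h1 : (a : R) * x ∈ (I.smul a).1 := Ideal.mem_span_singleton_mul.2 ⟨x, hx, rfl⟩
  obtain ⟨y, hy, hxy⟩ := Ideal.mem_span_singleton_mul.1 (h h1)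
  rwa [← mul_left_cancel₀ ha hxy]

theorem mem_smul_iff (a : R⁰) (I : NonzeroIdeal R) (x : R) :
    (a : R) * x ∈ (I.smul a).1 ↔ x ∈ I.1 := by
  have ha : (a : R) ≠ 0 := nonZeroDivisors.coe_ne_zero a
  refine ⟨fun h => ?_, fun h => Ideal.mem_span_singleton_mul.2 ⟨x, h, rfl⟩⟩
  obtain ⟨y, hy, hxy⟩ := Ideal.mem_span_singleton_mul.1 h
  rwa [← mul_left_cancel₀ ha hxy]

theorem scale_injective (a : R⁰) : Function.Injective (scale (R := R) a) := fun p q h => by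
  have ha : (a : R) ≠ 0 := nonZeroDivisors.coe_ne_zero a
  have h1 : p.2.smul a = q.2.smul a := (Prod.ext_iff.1 h).2
  refine Prod.ext (mul_left_cancel₀ ha (Prod.ext_iff.1 h).1) (Subtype.ext (le_antisymm ?_ ?_))
  · exact (smul_le_smul_iff a _ _).1 (by rw [h1])
  · exact (smul_le_smul_iff a _ _).1 (by rw [h1])

/-- The pairs `(r, C)` with `r ∈ I` and `C ⊆ I`. -/
def below (I : NonzeroIdeal R) : Set (R × NonzeroIdeal R) := {q | q.1 ∈ I.1 ∧ q.2.1 ≤ I.1}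

theorem scale_image_below (a : R⁰) (I : NonzeroIdeal R) :
    scale a '' below I = below (I.smul a) := by
  ext ⟨r, C⟩
  constructor
  · rintro ⟨⟨r', C'⟩, ⟨h1, h2⟩, h⟩
    obtain ⟨rfl, rfl⟩ := Prod.ext_iff.1 h
    exact ⟨(mem_smul_iff a I _).2 h1, (smul_le_smul_iff a _ _).2 h2⟩
  · rintro ⟨h1, h2⟩
    obtain ⟨r', hr', rfl⟩ := Ideal.mem_span_singleton_mul.1 h1
    -- As C ⊆ aI ⊆ aR, the ideal C is a times its preimage under multiplication by a.
    obtain ⟨C', hC'⟩ : Ideal.span {(a : R)} ∣ C.1 := ⟨_, (show C.1 = Ideal.span {(a : R)} *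
        Submodule.comap (LinearMap.mulLeft R (a : R)) C.1 from by
      refine le_antisymm (fun x hx => ?_) ?_
      · obtain ⟨y, hy, rfl⟩ := Ideal.mem_span_singleton_mul.1 (h2 hx)
        exact Ideal.mem_span_singleton_mul.2 ⟨y, hx, rfl⟩
      · intro x hx
        obtain ⟨y, hy, rfl⟩ := Ideal.mem_span_singleton_mul.1 hx
        exact hy)⟩
    have hne : C' ≠ ⊥ := by
      rintro rfl
      exact C.2 (hC'.trans (Submodule.mul_bot _))
    have hC : C = NonzeroIdeal.smul a ⟨C', hne⟩ := Subtype.ext hC'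
    subst hC
    exact ⟨(r', ⟨C', hne⟩), ⟨hr', (smul_le_smul_iff a _ _).1 h2⟩, rfl⟩

/-- The action of the generators. -/
def onGenerator : Generator R → (L2 (R × NonzeroIdeal R) ℂ →L[ℂ] L2 (R × NonzeroIdeal R) ℂ)
  | .u x => L2.extend (translate_injective x)
  | .s a => L2.extend (scale_injective a)
  | .e I => L2.proj (below I)

theorem onGenerator_rel (x y : FreeToeplitz R) (h : FreeToeplitz.Rel x y) :
    FreeStarAlgebra.lift onGenerator x = FreeStarAlgebra.lift onGenerator y := by
  have hu : ∀ x, FreeStarAlgebra.lift onGenerator (FreeToeplitz.u x) =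
    L2.extend (translate_injective (R := R) x) := fun x => FreeStarAlgebra.lift_gen _ _
  have hs : ∀ a, FreeStarAlgebra.lift onGenerator (FreeToeplitz.s a) =
    L2.extend (scale_injective (R := R) a) := fun x => FreeStarAlgebra.lift_gen _ _
  have he : ∀ I, FreeStarAlgebra.lift onGenerator (FreeToeplitz.e I) =
    L2.proj (below (R := R) I) := fun x => FreeStarAlgebra.lift_gen _ _
  have himage : ∀ (I : NonzeroIdeal R) (x : R), x ∈ I.1 → translate x '' below I = below I := by
    intro I x hx
    ext ⟨r, C⟩
    constructor
    · rintro ⟨⟨r', C'⟩, ⟨h1, h2⟩, h⟩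
      obtain ⟨rfl, rfl⟩ := Prod.ext_iff.1 h
      exact ⟨add_mem hx h1, h2⟩
    · rintro ⟨h1, h2⟩
      exact ⟨(-x + r, C), ⟨add_mem (neg_mem hx) h1, h2⟩, Prod.ext (by simp [translate]) rfl⟩
  cases h with
  | u_star_mul_self x => simp only [map_mul, map_star, map_one, hu, L2.star_extend_mul_extend]
  | u_mul_star_self x =>
    simp only [map_mul, map_star, map_one, hu]
    have h1 := L2.extend_mul_proj_mul_star_extend (H := ℂ) (translate_injective x) Set.univ
    rw [L2.proj_univ, mul_one] at h1
    rw [h1, Set.image_univ, Function.Surjective.range_eq, L2.proj_univ]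
    exact fun q => ⟨(-x + q.1, q.2), Prod.ext (by simp [translate]) rfl⟩
  | u_mul_u x y =>
    simp only [map_mul, hu, L2.extend_mul_extend]
    exact L2.extend_congr _ _ fun q => Prod.ext (add_assoc x y q.1).symm rfl
  | s_star_mul_self a => simp only [map_mul, map_star, map_one, hs, L2.star_extend_mul_extend]
  | s_mul_s a b =>
    simp only [map_mul, hs, L2.extend_mul_extend]
    refine L2.extend_congr _ _ fun q => Prod.ext (by simp [scale, mul_assoc]) (Subtype.ext ?_)
    simp [scale, NonzeroIdeal.smul, ← mul_assoc, Ideal.span_singleton_mul_span_singleton]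
  | s_mul_u a x =>
    simp only [map_mul, hs, hu, L2.extend_mul_extend]
    exact L2.extend_congr _ _ fun q => Prod.ext (mul_add (a : R) x q.1) rfl
  | e_star I => simp only [map_star, he, L2.star_proj]
  | e_mul_self I => simp only [map_mul, he, L2.proj_mul_proj, Set.inter_self]
  | e_inf I J =>
    simp only [map_mul, he, L2.proj_mul_proj]
    congr 1
    ext q
    simp only [below, NonzeroIdeal.inf, Submodule.mem_inf, le_inf_iff, Set.mem_ofPred_eq,
      Set.mem_inter_iff]
    tauto
  | e_top =>
    rw [he, map_one, ← L2.proj_univ]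
    congr 1
    ext q
    simp [below, NonzeroIdeal.top]
  | s_e_s a I =>
    simp only [map_mul, map_star, hs, he, L2.extend_mul_proj_mul_star_extend, scale_image_below]
  | u_comm_e I x hx =>
    simp only [map_mul, hu, he, L2.extend_mul_proj, himage I x hx]
  | e_u_e I x hx =>
    simp only [map_mul, map_zero, hu, he, mul_assoc, L2.extend_mul_proj]
    rw [← mul_assoc, L2.proj_mul_proj, Set.eq_empty_of_forall_notMem (s := _ ∩ _),
      L2.proj_empty, zero_mul]
    rintro q ⟨h1, ⟨q', h2, rfl⟩⟩
    refine hx ?_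
    have h3 : x + q'.1 ∈ I.1 := h1.1
    have h4 := sub_mem h3 h2.1
    rwa [add_sub_cancel_right] at h4

end IdealRep

/-- The representation of the Toeplitz algebra on the square summable families indexed by
pairs of an element and a non-zero ideal. -/
def idealRep : ToeplitzAlgebra R →⋆ₐ[ℂ]
    (L2 (R × NonzeroIdeal R) ℂ →L[ℂ] L2 (R × NonzeroIdeal R) ℂ) :=
  lift IdealRep.onGenerator IdealRep.onGenerator_rel

/-- The basis vector of a pair. -/
def idealVec {R : Type*} [CommRing R] (x : R) (C : NonzeroIdeal R) :
    L2 (R × NonzeroIdeal R) ℂ := L2.single (x, C) 1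

theorem idealVec_ne_zero {R : Type*} [CommRing R] (x : R) (C : NonzeroIdeal R) :
    idealVec x C ≠ 0 := by
  rw [← norm_ne_zero_iff, idealVec, L2.norm_single, norm_one]
  exact one_ne_zero

theorem idealRep_u_idealVec (y x : R) (C : NonzeroIdeal R) :
    idealRep (u y) (idealVec x C) = idealVec (y + x) C := by
  rw [idealRep, lift_u, idealVec, idealVec]
  exact L2.extend_single (IdealRep.translate_injective y) _ _

theorem idealRep_e_idealVec_of_mem {I : NonzeroIdeal R} {x : R} {C : NonzeroIdeal R}
    (hx : x ∈ I.1) (hC : C.1 ≤ I.1) : idealRep (e I) (idealVec x C) = idealVec x C := by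
  rw [idealRep, lift_e]
  refine lp.ext (funext fun q => ?_)
  by_cases hq : q ∈ IdealRep.below I
  · exact L2.proj_apply_of_mem hq _
  · refine (L2.proj_apply_of_notMem hq _).trans ?_
    rw [idealVec, L2.single_apply_ne]
    rintro rfl
    exact hq ⟨hx, hC⟩

theorem idealRep_e_idealVec_of_not_le {I : NonzeroIdeal R} {x : R} {C : NonzeroIdeal R}
    (hC : ¬ C.1 ≤ I.1) : idealRep (e I) (idealVec x C) = 0 := by
  rw [idealRep, lift_e]
  refine lp.ext (funext fun q => ?_)
  by_cases hq : q ∈ IdealRep.below I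
  · refine (L2.proj_apply_of_mem hq _).trans ?_
    rw [idealVec, L2.single_apply_ne]
    · rfl
    · rintro rfl
      exact hC hq.2
  · exact L2.proj_apply_of_notMem hq _

theorem idealRep_cosetProj_idealVec_of_le {I : NonzeroIdeal R} (x : R) {C : NonzeroIdeal R}
    (hC : C.1 ≤ I.1) : idealRep (cosetProj x I) (idealVec x C) = idealVec x C := by
  rw [cosetProj, map_mul, map_mul]
  change idealRep (u x) (idealRep (e I) (idealRep (u (-x)) (idealVec x C))) = _
  rw [idealRep_u_idealVec, neg_add_cancel, idealRep_e_idealVec_of_mem (zero_mem _) hC,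
    idealRep_u_idealVec, add_zero]

/-- The vanishing holds for all cosets of I at once and depends on C alone, so f_I vanishes on such
vectors too. This is why pairs with an ideal are needed: on families indexed by R alone, f_I would
act as 1 and every ε_{P^k} as 0. -/
theorem idealRep_cosetProj_idealVec_of_not_le {I : NonzeroIdeal R} (y x : R)
    {C : NonzeroIdeal R} (hC : ¬ C.1 ≤ I.1) : idealRep (cosetProj y I) (idealVec x C) = 0 := by
  rw [cosetProj, map_mul, map_mul]
  change idealRep (u y) (idealRep (e I) (idealRep (u (-y)) (idealVec x C))) = _
  rw [idealRep_u_idealVec, idealRep_e_idealVec_of_not_le hC, map_zero]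

instance : Nontrivial (ToeplitzAlgebra R) := by
  refine ⟨1, 0, fun h => ?_⟩
  have h1 := congrArg (fun t => idealRep t (idealVec (0 : R) NonzeroIdeal.top)) h
  simp only [map_one, map_zero] at h1
  exact idealVec_ne_zero _ _ h1

/-! ### The graded representation -/

section Graded

variable {K : Type*} [Field K]

/-- The permutation `(c, r) ↦ (c, r + c⁻¹ ζ)`. -/
def shear (ζ : K) : Equiv.Perm (Kˣ × K) where
  toFun q := (q.1, q.2 + (q.1⁻¹ : Kˣ) * ζ)
  invFun q := (q.1, q.2 - (q.1⁻¹ : Kˣ) * ζ)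
  left_inv q := by simp
  right_inv q := by simp

/-- The permutation `(c, r) ↦ (β c, r)`. -/
def dilate (β : Kˣ) : Equiv.Perm (Kˣ × K) where
  toFun q := (β * q.1, q.2)
  invFun q := (β⁻¹ * q.1, q.2)
  left_inv q := by simp
  right_inv q := by simp

theorem shear_mul_shear (ζ ξ : K) : shear ζ * shear ξ = shear (ζ + ξ) := by
  ext q
  · rfl
  · simp only [shear, Equiv.Perm.coe_mul, Equiv.coe_fn_mk, Function.comp_apply]; ring

theorem dilate_mul_dilate (β γ : Kˣ) : dilate β * dilate γ = dilate (β * γ) := by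
  ext q
  · simp [dilate, mul_assoc]
  · rfl

/-- The relation of the affine group, parallel to s_a u^x = u^{ax} s_a. The coordinates are chosen
so that the first is only multiplied and the second is shifted by an amount depending only on the
first, the shape required by `exists_almost_invariant_prod`. -/
theorem dilate_mul_shear (β : Kˣ) (ζ : K) :
    dilate β * shear ζ = shear (β * ζ) * dilate β := by
  ext q
  · rfl
  · simp only [shear, dilate, Equiv.Perm.coe_mul, Equiv.coe_fn_mk, Function.comp_apply]
    simp
    field_simp

theorem shear_zero : shear (0 : K) = 1 := by
  ext q <;> simp [shear]

variable [Algebra R K] [IsFractionRing R K]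

/-- The image of a non-zero element in the units of the field of fractions. -/
def toUnit (a : R⁰) : Kˣ :=
  Units.mk0 (algebraMap R K a) (IsFractionRing.to_map_ne_zero_of_mem_nonZeroDivisors a.2)

theorem toUnit_mul (a b : R⁰) : (toUnit (a * b) : Kˣ) = toUnit a * toUnit b :=
  Units.ext (by simp [toUnit])

theorem toUnit_injective : Function.Injective (toUnit (R := R) (K := K)) := fun _ _ h =>
  Subtype.ext (IsFractionRing.injective R K (congrArg Units.val h))

variable {H : Type*} [NormedAddCommGroup H] [InnerProductSpace ℂ H] [CompleteSpace H]
  (π : ToeplitzAlgebra R →⋆ₐ[ℂ] (H →L[ℂ] H))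

variable (K) in
/-- The action of the generators in the graded representation. -/
def gradedOnGenerator : Generator R → (L2 (Kˣ × K) H →L[ℂ] L2 (Kˣ × K) H)
  | .u x => L2.permute (shear (algebraMap R K x)) (π (u x))
  | .s a => L2.permute (dilate (toUnit a)) (π (s a))
  | .e I => L2.permute 1 (π (e I))

theorem gradedOnGenerator_rel (x y : FreeToeplitz R) (h : FreeToeplitz.Rel x y) :
    FreeStarAlgebra.lift (gradedOnGenerator K π) x =
      FreeStarAlgebra.lift (gradedOnGenerator K π) y := by
  have hu : ∀ x, FreeStarAlgebra.lift (gradedOnGenerator K π) (FreeToeplitz.u x) =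
    L2.permute (shear (algebraMap R K x)) (π (u x)) := fun x => FreeStarAlgebra.lift_gen _ _
  have hs : ∀ a, FreeStarAlgebra.lift (gradedOnGenerator K π) (FreeToeplitz.s a) =
    L2.permute (dilate (toUnit a)) (π (s a)) := fun x => FreeStarAlgebra.lift_gen _ _
  have he : ∀ I, FreeStarAlgebra.lift (gradedOnGenerator K π) (FreeToeplitz.e I) =
    L2.permute 1 (π (e I)) := fun x => FreeStarAlgebra.lift_gen _ _
  cases h <;> simp only [map_mul, map_star, map_one, map_zero, hu, hs, he, L2.star_permute,
    L2.permute_mul_permute]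
  all_goals try simp only [← map_star π, ← map_mul π]
  case u_star_mul_self x =>
    rw [star_u_mul_u, inv_mul_cancel, map_one, L2.permute_one]
  case u_mul_star_self x =>
    rw [u_mul_star_u, mul_inv_cancel, map_one, L2.permute_one]
  case u_mul_u x y => rw [shear_mul_shear, u_mul_u, map_add]
  case s_star_mul_self a => rw [star_s_mul_s, inv_mul_cancel, map_one, L2.permute_one]
  case s_mul_s a b => rw [dilate_mul_dilate, s_mul_s, toUnit_mul]
  case s_mul_u a x =>
    rw [dilate_mul_shear, s_mul_u]
    rfl
  case e_star I => rw [star_e, inv_one]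
  case e_mul_self I => rw [e_mul_self, one_mul]
  case e_inf I J => rw [e_mul_e, one_mul]
  case e_top => rw [e_top, map_one, L2.permute_one]
  case s_e_s a I => rw [s_e_s, mul_one, mul_inv_cancel]
  case u_comm_e I x hx => rw [u_comm_e I x hx, mul_one, one_mul]
  case e_u_e I x hx => rw [e_u_e I x hx, map_zero, L2.permute_zero]

variable (K) in
/-- The graded representation attached to a representation `π`: its value at a monomial is the
value of `π` combined with a permutation given by the degree. -/
def gradedRep : ToeplitzAlgebra R →⋆ₐ[ℂ] (L2 (Kˣ × K) H →L[ℂ] L2 (Kˣ × K) H) :=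
  lift (gradedOnGenerator K π) (gradedOnGenerator_rel π)

theorem gradedRep_u (x : R) :
    gradedRep K π (u x) = L2.permute (shear (algebraMap R K x)) (π (u x)) := lift_u _ _ _

theorem gradedRep_s (a : R⁰) :
    gradedRep K π (s a) = L2.permute (dilate (toUnit a)) (π (s a)) := lift_s _ _ _

theorem gradedRep_e (I : NonzeroIdeal R) :
    gradedRep K π (e I) = L2.permute 1 (π (e I)) := lift_e _ _ _

variable {π} in
theorem IsCosetProj.gradedRep_eq {p : ToeplitzAlgebra R} (hp : IsCosetProj p) :
    gradedRep K π p = L2.permute 1 (π p) := by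
  rcases hp with rfl | ⟨x, I, rfl⟩
  · rw [map_zero, map_zero, L2.permute_zero]
  · rw [cosetProj, map_mul, map_mul, gradedRep_u, gradedRep_e, gradedRep_u,
      L2.permute_mul_permute, L2.permute_mul_permute, ← map_mul, ← map_mul, mul_one,
      shear_mul_shear, map_neg, add_neg_cancel, shear_zero]

/-- A coset projection has trivial degree, so only a, b and z contribute to the permutation. -/
theorem gradedRep_monomial (a b : R⁰) (z : R) {p : ToeplitzAlgebra R} (hp : IsCosetProj p) :
    gradedRep K π (star (s a) * p * u z * s b) =
      L2.permute ((dilate (toUnit a))⁻¹ * shear (algebraMap R K z) * dilate (toUnit b))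
        (π (star (s a) * p * u z * s b)) := by
  rw [map_mul, map_mul, map_mul, map_star, gradedRep_s, gradedRep_u, gradedRep_s, hp.gradedRep_eq,
    L2.star_permute, L2.permute_mul_permute, L2.permute_mul_permute, L2.permute_mul_permute,
    ← map_star, ← map_mul, ← map_mul, ← map_mul, mul_one]

/-- The permutation of degree `(a, b, z)` in coordinates. -/
theorem degree_apply (a b : R⁰) (z : R) (q : Kˣ × K) :
    ((dilate (toUnit a))⁻¹ * shear (algebraMap R K z) * dilate (toUnit b) :
      Equiv.Perm (Kˣ × K)) q =
      ((toUnit a)⁻¹ * toUnit b * q.1,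
        q.2 + ((toUnit b * q.1)⁻¹ : Kˣ) * algebraMap R K z) := by
  refine Prod.ext ?_ rfl
  exact (mul_assoc _ _ _).symm

end Graded

end ToeplitzAlgebra

/-! ### Almost invariant finite sets -/

/-- Commutative groups satisfy the Følner condition. -/
theorem exists_almost_invariant {G : Type*} [CommGroup G] [DecidableEq G] (S : Finset G) {ε : ℝ}
    (hε : 0 < ε) :
    ∃ F : Finset G, F.Nonempty ∧ ∀ s ∈ S, (({f ∈ F | s * f ∉ F} : Finset G).card : ℝ) ≤
      ε * F.card := by
  -- Products of the elements of S with exponents from 0 to n. Their number grows at most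
  -- polynomially in n.
  let F : ℕ → Finset G := fun n =>
    (Fintype.piFinset fun _ : S => Finset.range (n + 1)).image fun k => ∏ s : S, (s : G) ^ k s
  have hmono : ∀ n, F n ⊆ F (n + 1) := fun n => Finset.image_subset_image
    (Fintype.piFinset_subset _ _ fun _ => Finset.range_mono (by omega))
  have hmul : ∀ n, ∀ s ∈ S, ∀ f ∈ F n, s * f ∈ F (n + 1) := by
    intro n s hs f hf
    obtain ⟨k, hk, rfl⟩ := Finset.mem_image.1 hf
    rw [Fintype.mem_piFinset] at hk
    refine Finset.mem_image.2 ⟨fun t => k t + if t = ⟨s, hs⟩ then 1 else 0, ?_, ?_⟩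
    · rw [Fintype.mem_piFinset]
      intro t
      have := Finset.mem_range.1 (hk t)
      rw [Finset.mem_range]
      split_ifs <;> omega
    · simp only [pow_add, Finset.prod_mul_distrib]
      rw [mul_comm]
      congr 1
      rw [Finset.prod_eq_single (⟨s, hs⟩ : S)] <;> simp +contextual
  have hcard : ∀ n, (F n).card ≤ (n + 1) ^ S.card := by
    intro n
    refine Finset.card_image_le.trans ?_
    simp
  have hne : ∀ n, (F n).Nonempty := fun n =>
    Finset.Nonempty.image ⟨fun _ => 0, by simp⟩ _
  have hbad : ∀ n, ∀ s ∈ S, ({f ∈ F n | s * f ∉ F n} : Finset G).card + (F n).card ≤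
      (F (n + 1)).card := by
    intro n s hs
    rw [← Finset.card_sdiff_add_card_eq_card (hmono n)]
    refine Nat.add_le_add_right (Finset.card_le_card_of_injOn (fun f => s * f) ?_ ?_) _
    · intro f hf
      obtain ⟨h1, h2⟩ := Finset.mem_filter.1 hf
      exact Finset.mem_coe.2 (Finset.mem_sdiff.2 ⟨hmul n s hs f h1, h2⟩)
    · exact fun _ _ _ _ h => mul_left_cancel h
  -- The elements of `F n` moved out of it by s are mapped injectively into the complement of `F n`
  -- in `F (n + 1)`, so a growth ratio of at most 1 + ε suffices. If every ratio exceeded 1 + ε,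
  -- growth would be exponential, against the bound (n + 1)^|S|.
  suffices h : ∃ n, ((F (n + 1)).card : ℝ) ≤ (1 + ε) * (F n).card by
    obtain ⟨n, hn⟩ := h
    refine ⟨F n, hne n, fun s hs => ?_⟩
    have h1 : (({f ∈ F n | s * f ∉ F n} : Finset G).card : ℝ) + (F n).card ≤
      (F (n + 1)).card := by exact_mod_cast hbad n s hs
    linarith
  by_contra! h
  have hpow : ∀ n, (1 + ε) ^ n ≤ ((F n).card : ℝ) := by
    intro n
    induction n with
    | zero =>
      rw [pow_zero]
      exact_mod_cast (hne 0).card_pos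
    | succ n ih =>
      rw [pow_succ']
      exact (mul_le_mul_of_nonneg_left ih (by linarith)).trans (h n).le
  have ht := (tendsto_pow_const_div_const_pow_of_one_lt S.card
    (show (1 : ℝ) < 1 + ε by linarith)).comp (Filter.tendsto_add_atTop_nat 1)
  obtain ⟨n, hn⟩ := (ht.eventually (gt_mem_nhds (show (0 : ℝ) < (1 + ε)⁻¹ by positivity))).exists
  simp only [Function.comp_apply] at hn
  have h1 : ((F n).card : ℝ) ≤ ((n + 1 : ℕ) : ℝ) ^ S.card := by exact_mod_cast hcard n
  have h2 := (hpow n).trans h1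
  rw [div_lt_iff₀ (by positivity), pow_succ', ← mul_assoc, inv_mul_cancel₀ (by positivity),
    one_mul] at hn
  linarith

/-- Almost invariant finite sets for finitely many maps `(c, r) ↦ (β c, r + τ c)`. -/
theorem exists_almost_invariant_prod {G N ι : Type*} [CommGroup G] [AddCommGroup N] [Finite ι]
    [DecidableEq G] [DecidableEq N] (σ : ι → G × N → G × N) (β : ι → G) (τ : ι → G → N)
    (hσ : ∀ i q, σ i q = (β i * q.1, q.2 + τ i q.1)) {ε : ℝ} (hε : 0 < ε) :
    ∃ F : Finset (G × N), F.Nonempty ∧ ∀ i,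
      (({q ∈ F | σ i q ∉ F} : Finset (G × N)).card : ℝ) ≤ ε * F.card := by
  have := Fintype.ofFinite ι
  obtain ⟨A, hA, hA'⟩ := exists_almost_invariant (Finset.univ.image β) (half_pos hε)
  -- The shift τ_i(c) depends on c, so B is chosen after A, for the finitely many shifts with c ∈ A.
  -- Each coordinate accounts for ε/2.
  obtain ⟨B', hB, hB'⟩ := exists_almost_invariant (G := Multiplicative N)
    ((Finset.univ ×ˢ A).image fun x : ι × G => Multiplicative.ofAdd (τ x.1 x.2)) (half_pos hε)
  let B : Finset N := B'
  have hBB : ∀ i, ∀ c ∈ A, (({r ∈ B | r + τ i c ∉ B} : Finset N).card : ℝ) ≤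
      ε / 2 * B.card := by
    intro i c hc
    have := hB' (Multiplicative.ofAdd (τ i c))
      (Finset.mem_image.2 ⟨(i, c), Finset.mem_product.2 ⟨Finset.mem_univ _, hc⟩, rfl⟩)
    refine le_trans (le_of_eq ?_) this
    congr 2
    refine Finset.filter_congr fun r _ => ?_
    rw [add_comm]
    rfl
  refine ⟨A ×ˢ B, hA.product hB, fun i => ?_⟩
  have hsub : ({q ∈ A ×ˢ B | σ i q ∉ A ×ˢ B} : Finset (G × N)) ⊆
      ({c ∈ A | β i * c ∉ A} : Finset G) ×ˢ B ∪
        A.biUnion fun c => {c} ×ˢ ({r ∈ B | r + τ i c ∉ B} : Finset N) := by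
    rintro ⟨c, r⟩ hq
    simp only [Finset.mem_filter, Finset.mem_product, hσ, Finset.mem_union, Finset.mem_biUnion,
      Finset.mem_singleton] at hq ⊢
    obtain ⟨⟨h1, h2⟩, h3⟩ := hq
    by_cases h4 : β i * c ∈ A
    · exact Or.inr ⟨c, h1, rfl, h2, fun h5 => h3 ⟨h4, h5⟩⟩
    · exact Or.inl ⟨⟨h1, h4⟩, h2⟩
  have h1 := hA' (β i) (Finset.mem_image_of_mem _ (Finset.mem_univ i))
  have h2 : ((A.biUnion fun c => ({c} : Finset G) ×ˢ
      ({r ∈ B | r + τ i c ∉ B} : Finset N)).card : ℝ) ≤ A.card * (ε / 2 * B.card) := by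
    calc _ ≤ ((∑ c ∈ A, (({c} : Finset G) ×ˢ
          ({r ∈ B | r + τ i c ∉ B} : Finset N)).card : ℕ) : ℝ) := by
          exact_mod_cast Finset.card_biUnion_le
      _ = ∑ c ∈ A, (({r ∈ B | r + τ i c ∉ B} : Finset N).card : ℝ) := by
          push_cast
          refine Finset.sum_congr rfl fun c _ => ?_
          simp
      _ ≤ ∑ c ∈ A, ε / 2 * B.card := Finset.sum_le_sum fun c hc => hBB i c hc
      _ = _ := by rw [Finset.sum_const, nsmul_eq_mul]
  have h3 : ((({q ∈ A ×ˢ B | σ i q ∉ A ×ˢ B} : Finset (G × N)).card : ℕ) : ℝ) ≤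
      (({c ∈ A | β i * c ∉ A} : Finset G).card * B.card : ℝ) +
        (A.biUnion fun c => ({c} : Finset G) ×ˢ
          ({r ∈ B | r + τ i c ∉ B} : Finset N)).card := by
    have := (Finset.card_le_card hsub).trans (Finset.card_union_le _ _)
    rw [Finset.card_product] at this
    exact_mod_cast this
  have h4 := mul_le_mul_of_nonneg_right h1 (Nat.cast_nonneg (α := ℝ) B.card)
  rw [Finset.card_product, Nat.cast_mul]
  linarith

namespace ToeplitzAlgebra

open L2

variable {R : Type*} [CommRing R] [IsDomain R]

/-! ### Vanishing in the graded representation -/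

/-- Every element of the dense subalgebra is a finite combination of monomials. -/
theorem exists_sum_monomials {y : ToeplitzAlgebra R} (hy : y ∈ Submodule.span ℂ (monomials R)) :
    ∃ (n : ℕ) (c : Fin n → ℂ) (a b : Fin n → R⁰) (z : Fin n → R) (p : Fin n → ToeplitzAlgebra R),
      (∀ i, IsCosetProj (p i)) ∧
        y = ∑ i, c i • (star (s (a i)) * p i * u (z i) * s (b i)) := by
  obtain ⟨n, c, t, rfl⟩ := Submodule.mem_span_set'.1 hy
  choose a b z p hp ht using fun i => (t i).2
  exact ⟨n, c, a, b, z, p, hp, Finset.sum_congr rfl fun i _ => by rw [← ht i]⟩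

theorem dense_span_monomials :
    Dense (Submodule.span ℂ (monomials R) : Set (ToeplitzAlgebra R)) := fun y => by
  induction y using ToeplitzAlgebra.induction with
  | closed => exact isClosed_closure
  | mk x => exact subset_closure (mk_mem_span_monomials x)

variable {K : Type*} [Field K] [Algebra R K] [IsFractionRing R K]
  {H : Type*} [NormedAddCommGroup H] [InnerProductSpace ℂ H] [CompleteSpace H]
  (π : ToeplitzAlgebra R →⋆ₐ[ℂ] (H →L[ℂ] H))

open Classical in
/-- The diagonal coefficients of the graded representation are given by the part of degree
one. -/
theorem inner_gradedRep_single {n : ℕ} (c : Fin n → ℂ) (a b : Fin n → R⁰) (z : Fin n → R)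
    (p : Fin n → ToeplitzAlgebra R) (hp : ∀ i, IsCosetProj (p i)) (q : Kˣ × K) (v w : H) :
    inner ℂ (single q w)
        (gradedRep K π (∑ i, c i • (star (s (a i)) * p i * u (z i) * s (b i))) (single q v)) =
      inner ℂ w (π (∑ i with a i = b i ∧ z i = 0,
        c i • (star (s (a i)) * p i * u (z i) * s (b i))) v) := by
  rw [map_sum, map_sum, sum_apply, sum_apply, inner_sum,
    inner_sum, Finset.sum_filter]
  refine Finset.sum_congr rfl fun i _ => ?_
  rw [map_smul, map_smul, smul_apply, smul_apply,
    inner_smul_right, inner_smul_right, gradedRep_monomial _ _ _ _ (hp i), permute_single,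
    inner_single, degree_apply]
  -- The permutation of degree (a, b, z) fixes q exactly when a = b and z = 0, because `R` embeds in
  -- its field of fractions.
  split_ifs with h
  · obtain ⟨h1, h2⟩ := h
    have hq : q = ((toUnit (a i))⁻¹ * toUnit (b i) * q.1,
        q.2 + ((toUnit (b i) * q.1)⁻¹ : Kˣ) * algebraMap R K (z i)) := by
      rw [h1, h2]
      simp
    rw [← hq, single_apply_self]
  · rw [single_apply_ne, inner_zero_right, mul_zero]
    intro hq
    obtain ⟨h1, h2⟩ := Prod.ext_iff.1 hq
    refine h ⟨?_, ?_⟩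
    · have h3 : (toUnit (a i) : Kˣ)⁻¹ * toUnit (b i) = 1 := by simpa using h1
      exact toUnit_injective (K := K) (inv_mul_eq_one.1 h3)
    · have h3 : algebraMap R K (z i) = 0 := by simpa using h2
      exact (FaithfulSMul.algebraMap_injective R K) (by rw [h3, map_zero])

/-- An element is annihilated by a representation if the associated graded representation
annihilates all families with one entry. -/
theorem eq_zero_of_gradedRep_single_eq_zero {y : ToeplitzAlgebra R}
    (hy : ∀ (q : Kˣ × K) (v : H), gradedRep K π y (single q v) = 0) : π y = 0 := by
  classical
  refine ContinuousLinearMap.ext fun v => ext_inner_left ℂ fun w => ?_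
  rw [zero_apply, inner_zero_right, ← norm_eq_zero]
  have hbound : ∀ x : ToeplitzAlgebra R, ‖inner ℂ w (π x v)‖ ≤ ‖x‖ * (‖w‖ * ‖v‖) := by
    intro x
    calc _ ≤ ‖w‖ * ‖π x v‖ := norm_inner_le_norm _ _
      _ ≤ ‖w‖ * (‖x‖ * ‖v‖) := by
        gcongr
        exact ((π x).le_opNorm v).trans (by gcongr; exact NonUnitalStarAlgHom.norm_apply_le π x)
      _ = _ := by ring
  -- One ε comes from replacing y by a combination y' of monomials in the graded representation, one
  -- from the failure of invariance of the Følner set, and one from the same replacement in π.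
  have key : ∀ ε > 0, ‖inner ℂ w (π y v)‖ ≤ 3 * ε * (‖w‖ * ‖v‖) := by
    intro ε hε
    obtain ⟨y', hy', hyy⟩ := Metric.mem_closure_iff.1 (dense_span_monomials y) ε hε
    rw [dist_eq_norm] at hyy
    obtain ⟨n, c, a, b, z, p, hp, hsum⟩ := exists_sum_monomials hy'
    set t : Fin n → ToeplitzAlgebra R := fun i => star (s (a i)) * p i * u (z i) * s (b i) with ht
    set M := ∑ i, ‖c i‖ * ‖t i‖ with hM
    have hM0 : 0 ≤ M := Finset.sum_nonneg fun i _ => by positivity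
    let σ : Fin n → Equiv.Perm (Kˣ × K) := fun i =>
      (dilate (toUnit (a i)))⁻¹ * shear (algebraMap R K (z i)) * dilate (toUnit (b i))
    -- M bounds the sum of the norms of the terms of y', so the total defect of invariance is at
    -- most ε M / (M + 1) per element of F; the added 1 keeps the denominator positive.
    obtain ⟨F, hF, hF'⟩ := exists_almost_invariant_prod (fun i => σ i)
      (fun i => (toUnit (a i))⁻¹ * toUnit (b i))
      (fun i c => ((toUnit (b i) * c)⁻¹ : Kˣ) * algebraMap R K (z i))
      (fun i q => degree_apply (a i) (b i) (z i) q) (show 0 < ε / (M + 1) by positivity)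
    have hFc : (0 : ℝ) < F.card := by exact_mod_cast hF.card_pos
    have hind : ∀ (x : Kˣ × K) (v' : H), inner ℂ (∑ q ∈ F, single q w) (single x v') =
        if x ∈ F then inner ℂ w v' else 0 := by
      intro x v'
      rw [sum_inner]
      simp_rw [inner_single]
      split_ifs with hx
      · rw [Finset.sum_eq_single_of_mem x hx, single_apply_self]
        intro q _ hq
        rw [single_apply_ne _ hq, inner_zero_right]
      · refine Finset.sum_eq_zero fun q hq => ?_
        rw [single_apply_ne, inner_zero_right]
        rintro rfl
        exact hx hq
    -- Each q ∈ F whose image stays in F contributes one full coefficient of π; the others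
    -- contribute nothing.
    have hinner : ∀ i, inner ℂ (∑ q ∈ F, single q w)
        (gradedRep K π (t i) (∑ q ∈ F, single q v)) =
          (F.card - (({q ∈ F | σ i q ∉ F} : Finset (Kˣ × K)).card : ℂ)) *
            inner ℂ w (π (t i) v) := by
      intro i
      have h0 : gradedRep K π (t i) = permute (σ i) (π (t i)) := gradedRep_monomial _ _ _ _ (hp i)
      rw [map_sum, inner_sum, h0]
      simp_rw [permute_single, hind]
      rw [← Finset.sum_filter, Finset.sum_const, nsmul_eq_mul]
      congr 1
      rw [← Finset.card_filter_add_card_filter_not (s := F) (fun q => σ i q ∈ F)]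
      push_cast
      ring
    have h1 : ‖inner ℂ (∑ q ∈ F, single q w) (gradedRep K π y' (∑ q ∈ F, single q v))‖ ≤
        ε * F.card * (‖w‖ * ‖v‖) := by
      have h2 : gradedRep K π y' (∑ q ∈ F, single q v) =
          gradedRep K π (y' - y) (∑ q ∈ F, single q v) := by
        rw [map_sub, sub_apply, map_sum (gradedRep K π y)]
        simp_rw [hy]
        simp
      rw [h2]
      have h3 : ‖(∑ q ∈ F, single q w : L2 (Kˣ × K) H)‖ *
          ‖(∑ q ∈ F, single q v : L2 (Kˣ × K) H)‖ = F.card * (‖w‖ * ‖v‖) := by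
        refine (pow_left_inj₀ (by positivity) (by positivity) two_ne_zero).1 ?_
        rw [mul_pow, norm_sum_single, norm_sum_single]
        ring
      calc _ ≤ ‖(∑ q ∈ F, single q w : L2 (Kˣ × K) H)‖ * (‖gradedRep K π (y' - y)‖ *
              ‖(∑ q ∈ F, single q v : L2 (Kˣ × K) H)‖) :=
            (norm_inner_le_norm _ _).trans
              (mul_le_mul_of_nonneg_left (ContinuousLinearMap.le_opNorm _ _) (norm_nonneg _))
        _ = ‖gradedRep K π (y' - y)‖ * (F.card * (‖w‖ * ‖v‖)) := by rw [← h3]; ring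
        _ ≤ ε * (F.card * (‖w‖ * ‖v‖)) := by
            refine mul_le_mul_of_nonneg_right ?_ (by positivity)
            refine (NonUnitalStarAlgHom.norm_apply_le (gradedRep K π) _).trans ?_
            rw [norm_sub_rev]
            exact hyy.le
        _ = _ := by ring
    have h2 : inner ℂ (∑ q ∈ F, single q w) (gradedRep K π y' (∑ q ∈ F, single q v)) =
        F.card * inner ℂ w (π y' v) - ∑ i, c i *
          ((({q ∈ F | σ i q ∉ F} : Finset (Kˣ × K)).card : ℂ) * inner ℂ w (π (t i) v)) := by
      have e1 : gradedRep K π y' (∑ q ∈ F, single q v) =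
          ∑ i, c i • gradedRep K π (t i) (∑ q ∈ F, single q v) := by
        rw [hsum, map_sum (gradedRep K π), sum_apply]
        exact Finset.sum_congr rfl fun i _ => by rw [map_smul]; rfl
      have e2 : π y' v = ∑ i, c i • π (t i) v := by
        rw [hsum, map_sum π, sum_apply]
        exact Finset.sum_congr rfl fun i _ => by rw [map_smul]; rfl
      rw [e1, e2, inner_sum, inner_sum, Finset.mul_sum, ← Finset.sum_sub_distrib]
      refine Finset.sum_congr rfl fun i _ => ?_
      rw [inner_smul_right, inner_smul_right, hinner]
      ring
    have h3 : ‖∑ i, c i * ((({q ∈ F | σ i q ∉ F} : Finset (Kˣ × K)).card : ℂ) *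
        inner ℂ w (π (t i) v))‖ ≤ ε * F.card * (‖w‖ * ‖v‖) := by
      calc _ ≤ ∑ i, ‖c i‖ * (ε / (M + 1) * F.card * (‖t i‖ * (‖w‖ * ‖v‖))) := by
            refine norm_sum_le_of_le _ fun i _ => ?_
            rw [norm_mul, norm_mul, Complex.norm_natCast]
            gcongr
            · exact hF' i
            · exact hbound _
        _ = M / (M + 1) * (ε * F.card * (‖w‖ * ‖v‖)) := by
            rw [hM, Finset.sum_div, Finset.sum_mul]
            refine Finset.sum_congr rfl fun i _ => ?_
            ring
        _ ≤ 1 * (ε * F.card * (‖w‖ * ‖v‖)) := by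
            refine mul_le_mul_of_nonneg_right ?_ (by positivity)
            rw [div_le_one (by positivity)]
            linarith
        _ = _ := one_mul _
    have h4 : F.card * ‖inner ℂ w (π y' v)‖ ≤ F.card * (2 * ε * (‖w‖ * ‖v‖)) := by
      have h5 : (F.card : ℂ) * inner ℂ w (π y' v) =
          inner ℂ (∑ q ∈ F, single q w) (gradedRep K π y' (∑ q ∈ F, single q v)) +
          ∑ i, c i * ((({q ∈ F | σ i q ∉ F} : Finset (Kˣ × K)).card : ℂ) *
            inner ℂ w (π (t i) v)) := by rw [h2]; ring
      calc _ = ‖(F.card : ℂ) * inner ℂ w (π y' v)‖ := by rw [norm_mul, Complex.norm_natCast]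
        _ ≤ _ := by
          rw [h5]
          refine (norm_add_le _ _).trans ((add_le_add h1 h3).trans_eq ?_)
          ring
    have h5 := le_of_mul_le_mul_left h4 hFc
    have h6 := hbound (y - y')
    have h7 : inner ℂ w (π y v) = inner ℂ w (π y' v) + inner ℂ w (π (y - y') v) := by
      rw [← inner_add_right, map_sub, sub_apply, add_sub_cancel]
    rw [h7]
    refine (norm_add_le _ _).trans ?_
    have h8 : ‖y - y'‖ * (‖w‖ * ‖v‖) ≤ ε * (‖w‖ * ‖v‖) := by gcongr
    linarith
  refine le_antisymm (le_of_forall_pos_le_add fun δ hδ => ?_) (norm_nonneg _)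
  have h := key (δ / (3 * (‖w‖ * ‖v‖ + 1))) (by positivity)
  refine h.trans ?_
  rw [zero_add]
  have h9 : 3 * (δ / (3 * (‖w‖ * ‖v‖ + 1))) * (‖w‖ * ‖v‖) =
      δ * ((‖w‖ * ‖v‖) / (‖w‖ * ‖v‖ + 1)) := by field_simp
  rw [h9]
  refine mul_le_of_le_one_right hδ.le ?_
  rw [div_le_one (by positivity)]
  linarith

end ToeplitzAlgebra

namespace ToeplitzAlgebra

open IsDedekindDomain

/-! ### Minimal projections in the algebras `D_n` -/

section Lists

variable {T : Type*} [MonoidWithZero T]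

theorem mul_list_prod_eq_zero {e z : T} : ∀ {L : List T}, (∀ w ∈ L, e * w = w * e) → z ∈ L →
    e * z = 0 → e * L.prod = 0
  | [], _, hz, _ => by simp at hz
  | w :: L, hL, hz, h => by
    rw [List.prod_cons, ← mul_assoc]
    rcases List.mem_cons.1 hz with rfl | hz
    · rw [h, zero_mul]
    · rw [hL w List.mem_cons_self, mul_assoc, mul_list_prod_eq_zero
        (fun w' hw' => hL w' (List.mem_cons_of_mem w hw')) hz h, mul_zero]

theorem mul_list_prod_eq_self {e z : T} : ∀ {L : List T}, (∀ w ∈ L, e * w = w * e) → z ∈ L →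
    e * z = z → e * L.prod = L.prod
  | [], _, hz, _ => by simp at hz
  | w :: L, hL, hz, h => by
    rw [List.prod_cons, ← mul_assoc]
    rcases List.mem_cons.1 hz with rfl | hz
    · rw [h]
    · rw [hL w List.mem_cons_self, mul_assoc, mul_list_prod_eq_self
        (fun w' hw' => hL w' (List.mem_cons_of_mem w hw')) hz h]

end Lists

/-! ### The sums f_I: products with coset projections and action on basis vectors. -/

section

variable {R : Type*} [CommRing R] [IsDomain R] [Ring.HasFiniteQuotients R]

theorem f_eq_sum {R : Type*} [CommRing R] [IsDomain R] (I : NonzeroIdeal R) [Fintype (R ⧸ I.1)] :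
    f I = ∑ c : R ⧸ I.1, cosetProj (Quotient.out c) I :=
  finsum_eq_sum_of_fintype _

theorem cosetProj_mul_f_comm (y : R) (J I : NonzeroIdeal R) :
    cosetProj y J * f I = f I * cosetProj y J := by
  have : Finite (R ⧸ I.1) := Ring.HasFiniteQuotients.finiteQuotient I.2
  have := Fintype.ofFinite (R ⧸ I.1)
  rw [f_eq_sum, Finset.mul_sum, Finset.sum_mul]
  exact Finset.sum_congr rfl fun c _ => cosetProj_mul_comm _ _ _ _

/-- The coset y + J lies in exactly one coset of I and is disjoint from the others, so a single
summand survives. -/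
theorem cosetProj_mul_f {y : R} {J I : NonzeroIdeal R} (h : J.1 ≤ I.1) :
    cosetProj y J * f I = cosetProj y J := by
  have : Finite (R ⧸ I.1) := Ring.HasFiniteQuotients.finiteQuotient I.2
  have := Fintype.ofFinite (R ⧸ I.1)
  have hout : ∀ c : R ⧸ I.1, Ideal.Quotient.mk I.1 (Quotient.out c) = c := fun c =>
    Quotient.out_eq' c
  rw [f_eq_sum, Finset.mul_sum, Finset.sum_eq_single (Ideal.Quotient.mk I.1 y)]
  · refine cosetProj_mul_of_le h ?_
    rw [← Ideal.Quotient.eq, hout]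
  · intro c _ hc
    refine cosetProj_mul_eq_zero I.1 h le_rfl fun h1 => hc ?_
    rw [← Ideal.Quotient.eq, hout] at h1
    exact h1.symm
  · simp

theorem idealRep_f_idealVec_of_not_le {I : NonzeroIdeal R} (x : R) {C : NonzeroIdeal R}
    (hC : ¬ C.1 ≤ I.1) : idealRep (f I) (idealVec x C) = 0 := by
  have : Finite (R ⧸ I.1) := Ring.HasFiniteQuotients.finiteQuotient I.2
  have := Fintype.ofFinite (R ⧸ I.1)
  rw [f_eq_sum, map_sum, sum_apply]
  exact Finset.sum_eq_zero fun c _ => idealRep_cosetProj_idealVec_of_not_le _ _ hC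

/-- The basis vector is fixed by the projection of x + C, which lies below f_I. -/
theorem idealRep_f_idealVec_of_le {I : NonzeroIdeal R} (x : R) {C : NonzeroIdeal R}
    (hC : C.1 ≤ I.1) : idealRep (f I) (idealVec x C) = idealVec x C := by
  have h : idealRep (f I * cosetProj x C) (idealVec x C) = idealRep (cosetProj x C)
      (idealVec x C) := by
    rw [← cosetProj_mul_f_comm, cosetProj_mul_f hC]
  rw [map_mul] at h
  change idealRep (f I) (idealRep (cosetProj x C) (idealVec x C)) = _ at h
  rwa [idealRep_cosetProj_idealVec_of_le x le_rfl] at h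

end

/-! ### Atoms of the algebras D_n and their interaction with coset projections. -/

section

variable {R : Type*} [CommRing R] [IsDedekindDomain R]

open NonzeroIdeal

/-- The minimal projection of `D_P` belonging to the coset `x + P ^ k`. -/
def primeAtom (P : HeightOneSpectrum R) (x : R) (k : ℕ) : ToeplitzAlgebra R :=
  cosetProj x (primePow P k) * epsilon P (k + 1) * 1

theorem primeAtom_mem (P : HeightOneSpectrum R) (x : R) (k : ℕ) : primeAtom P x k ∈ DPrime P := by
  have hmem : ∀ y j, cosetProj y (primePow P j) ∈ DbarPrime P := fun y j =>
    NonUnitalStarSubalgebra.le_topologicalClosure _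
      (NonUnitalStarAlgebra.subset_adjoin ℂ _ ⟨y, j, rfl⟩)
  -- The final factor 1 in `primeAtom` makes it literally of the form d ε d'; it belongs to D̄_P as
  -- e_{P^0}.
  refine Submodule.le_topologicalClosure _ (Submodule.subset_span
    ⟨_, hmem x k, k + 1, by omega, 1, ?_, rfl⟩)
  have h := hmem 0 0
  have h0 : primePow P 0 = NonzeroIdeal.top := Subtype.ext (by simp [primePow, NonzeroIdeal.top])
  rwa [h0, cosetProj_top] at h

theorem cosetProj_mul_primeAtom_self (P : HeightOneSpectrum R) (x : R) (k : ℕ) :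
    cosetProj x (primePow P k) * primeAtom P x k = primeAtom P x k := by
  rw [primeAtom, ← mul_assoc, ← mul_assoc, cosetProj_mul_of_le le_rfl (by simp)]

/-- The minimal projection of `D_n` belonging to the coset of `x` modulo the product of the
`P_i ^ {k_i}`. -/
def atom (P : ℕ → HeightOneSpectrum R) (n : ℕ) (x : R) (k : ℕ → ℕ) : ToeplitzAlgebra R :=
  (List.ofFn fun i : Fin n => primeAtom (P i) x (k i)).prod

theorem atom_mem (P : ℕ → HeightOneSpectrum R) (n : ℕ) (x : R) (k : ℕ → ℕ) :
    atom P n x k ∈ D P n := by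
  have key : ∀ (n : ℕ) (P : Fin n → HeightOneSpectrum R) (k : Fin n → ℕ),
      (List.ofFn fun i => primeAtom (P i) x (k i)).prod ∈
        (List.ofFn fun i => DPrime (P i)).prod := by
    intro n
    induction n with
    | zero => intro P k; simp
    | succ n ih =>
      intro P k
      rw [List.ofFn_succ, List.ofFn_succ, List.prod_cons, List.prod_cons]
      exact Submodule.mul_mem_mul (primeAtom_mem _ _ _) (ih _ _)
  exact Submodule.le_topologicalClosure _ (key n (fun i => P i) (fun i => k i))

/-- Divisibility of non-zero ideals can be tested on powers of primes. -/
theorem ideal_le_iff_forall_pow_le {I J : Ideal R} (hJ : J ≠ ⊥) :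
    I ≤ J ↔ ∀ (v : HeightOneSpectrum R) (l : ℕ), J ≤ v.asIdeal ^ l → I ≤ v.asIdeal ^ l := by
  refine ⟨fun h v l hl => h.trans hl, fun h => ?_⟩
  rw [← Ideal.dvd_iff_le, UniqueFactorizationMonoid.dvd_iff_emultiplicity_le hJ]
  intro p hp
  rw [emultiplicity_le_emultiplicity_iff]
  intro l hl
  have := h ⟨p, Ideal.isPrime_of_prime hp, hp.ne_zero⟩ l (Ideal.le_of_dvd hl)
  exact Ideal.dvd_iff_le.2 this

variable [Ring.HasFiniteQuotients R]

theorem cosetProj_mul_primeAtom_comm (P : HeightOneSpectrum R) (x : R) (k : ℕ) (y : R)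
    (J : NonzeroIdeal R) : cosetProj y J * primeAtom P x k = primeAtom P x k * cosetProj y J := by
  rw [primeAtom, epsilon, mul_one, ← mul_assoc, cosetProj_mul_comm y x, mul_assoc, mul_assoc,
    mul_sub, sub_mul, cosetProj_mul_f_comm, cosetProj_mul_f_comm]

/-- The projection of y + J lies below both f_{P^k} and f_{P^{k+1}}, so their difference annihilates
it. An atom thus sees the exponent of P as exactly k. -/
theorem cosetProj_mul_primeAtom_eq_zero {P : HeightOneSpectrum R} (x : R) {k : ℕ} (y : R)
    {J : NonzeroIdeal R} (hJ : J.1 ≤ P.asIdeal ^ (k + 1)) :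
    cosetProj y J * primeAtom P x k = 0 := by
  rw [primeAtom, epsilon, mul_one, ← mul_assoc, cosetProj_mul_comm y x, mul_assoc, mul_sub,
    cosetProj_mul_f (I := primePow P (k + 1)) hJ, Nat.add_sub_cancel,
    cosetProj_mul_f (I := primePow P k) (hJ.trans (Ideal.pow_le_pow_right (Nat.le_succ k))),
    sub_self, mul_zero]

theorem idealRep_primeAtom_idealVec {P : HeightOneSpectrum R} (x : R) {k : ℕ}
    {C : NonzeroIdeal R} (h : C.1 ≤ P.asIdeal ^ k) (h' : ¬ C.1 ≤ P.asIdeal ^ (k + 1)) :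
    idealRep (primeAtom P x k) (idealVec x C) = idealVec x C := by
  rw [primeAtom, epsilon, mul_one, Nat.add_sub_cancel, map_mul, map_sub]
  change idealRep (cosetProj x (primePow P k)) (idealRep (f (primePow P k)) (idealVec x C) -
    idealRep (f (primePow P (k + 1))) (idealVec x C)) = _
  rw [idealRep_f_idealVec_of_le (I := primePow P k) x h,
    idealRep_f_idealVec_of_not_le (I := primePow P (k + 1)) x h', sub_zero,
    idealRep_cosetProj_idealVec_of_le (I := primePow P k) x h]

theorem cosetProj_mul_atom_eq_zero {P : ℕ → HeightOneSpectrum R} {n : ℕ} {i : ℕ} (hi : i < n)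
    (x : R) (k : ℕ → ℕ) (y : R) {J : NonzeroIdeal R} (hJ : J.1 ≤ (P i).asIdeal ^ (k i + 1)) :
    cosetProj y J * atom P n x k = 0 := by
  refine mul_list_prod_eq_zero (z := primeAtom (P i) x (k i)) (fun w hw => ?_) ?_
    (cosetProj_mul_primeAtom_eq_zero x y hJ)
  · obtain ⟨j, rfl⟩ := (List.mem_ofFn' _ _).1 hw
    exact cosetProj_mul_primeAtom_comm _ _ _ _ _
  · exact (List.mem_ofFn' _ _).2 ⟨⟨i, hi⟩, rfl⟩

theorem cosetProj_mul_atom_self {P : ℕ → HeightOneSpectrum R} {n : ℕ} {i : ℕ} (hi : i < n)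
    (x : R) (k : ℕ → ℕ) : cosetProj x (primePow (P i) (k i)) * atom P n x k = atom P n x k := by
  refine mul_list_prod_eq_self (z := primeAtom (P i) x (k i)) (fun w hw => ?_) ?_
    (cosetProj_mul_primeAtom_self _ _ _)
  · obtain ⟨j, rfl⟩ := (List.mem_ofFn' _ _).1 hw
    exact cosetProj_mul_primeAtom_comm _ _ _ _ _
  · exact (List.mem_ofFn' _ _).2 ⟨⟨i, hi⟩, rfl⟩

/-- The intersection of the P_i^{k_i} serves as A: each coset x + P_i^{k_i} fixes the atom. -/
theorem exists_cosetProj_mul_atom (P : ℕ → HeightOneSpectrum R) (n : ℕ) (x : R) (k : ℕ → ℕ) :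
    ∃ A : NonzeroIdeal R, (∀ i < n, A.1 ≤ (P i).asIdeal ^ k i) ∧
      cosetProj x A * atom P n x k = atom P n x k := by
  suffices h : ∀ m ≤ n, ∃ A : NonzeroIdeal R, (∀ i < m, A.1 ≤ (P i).asIdeal ^ k i) ∧
      cosetProj x A * atom P n x k = atom P n x k from h n le_rfl
  intro m
  induction m with
  | zero => exact fun _ => ⟨NonzeroIdeal.top, by simp, by rw [cosetProj_top, one_mul]⟩
  | succ m ih =>
    intro hm
    obtain ⟨A, hA, hA'⟩ := ih (by omega)
    refine ⟨A.inf (primePow (P m) (k m)), fun i hi => ?_, ?_⟩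
    · rcases Nat.lt_succ_iff_lt_or_eq.1 hi with h | rfl
      · exact inf_le_left.trans (hA i h)
      · exact inf_le_right
    · rw [← cosetProj_mul_cosetProj_self, mul_assoc, cosetProj_mul_atom_self hm, hA']

/-- With C the product of the P_i^{k_i}, every factor of the atom fixes the basis vector of (x, C)
in `idealRep`. The primes being distinct, P_i occurs in C with exponent exactly k_i. -/
theorem atom_ne_zero {P : ℕ → HeightOneSpectrum R} (hP : Function.Injective P) (n : ℕ) (x : R)
    (k : ℕ → ℕ) : atom P n x k ≠ 0 := by
  let C : NonzeroIdeal R := ⟨∏ i ∈ Finset.range n, (P i).asIdeal ^ k i,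
    Finset.prod_ne_zero_iff.2 fun i _ => (primePow (P i) (k i)).2⟩
  have h1 : ∀ i < n, C.1 ≤ (P i).asIdeal ^ k i := fun i hi =>
    Ideal.le_of_dvd (Finset.dvd_prod_of_mem (fun i => (P i).asIdeal ^ k i) (Finset.mem_range.2 hi))
  have h2 : ∀ i < n, ¬ C.1 ≤ (P i).asIdeal ^ (k i + 1) := by
    intro i hi h
    have h3 := Ideal.dvd_iff_le.2 h
    change _ ∣ ∏ i ∈ Finset.range n, (P i).asIdeal ^ k i at h3
    rw [← Finset.mul_prod_erase _ _ (Finset.mem_range.2 hi), pow_succ] at h3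
    have h4 := (mul_dvd_mul_iff_left (primePow (P i) (k i)).2).1 h3
    obtain ⟨j, hj, hj'⟩ := ((P i).prime.dvd_finsetProd_iff _).1 h4
    have h5 := Ideal.le_of_dvd ((P i).prime.dvd_of_dvd_pow hj')
    have h6 : P j = P i := HeightOneSpectrum.ext ((P j).isMaximal.eq_of_le (P i).isPrime.ne_top h5)
    exact (Finset.mem_erase.1 hj).1 (hP h6)
  have h3 : ∀ L : List (ToeplitzAlgebra R), (∀ w ∈ L, idealRep w (idealVec x C) = idealVec x C) →
      idealRep L.prod (idealVec x C) = idealVec x C := by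
    intro L
    induction L with
    | nil => intro _; simp
    | cons w L ih =>
      intro h
      rw [List.prod_cons, map_mul]
      change idealRep w (idealRep L.prod (idealVec x C)) = _
      rw [ih fun w' hw' => h w' (List.mem_cons_of_mem w hw'), h w List.mem_cons_self]
  intro h0
  have h4 := h3 (List.ofFn fun i : Fin n => primeAtom (P i) x (k i)) (by
    intro w hw
    obtain ⟨j, rfl⟩ := (List.mem_ofFn' _ _).1 hw
    exact idealRep_primeAtom_idealVec x (h1 j j.2) (h2 j j.2))
  change idealRep (atom P n x k) _ = _ at h4
  rw [h0, map_zero] at h4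
  exact idealVec_ne_zero x C h4.symm

/-- There are minimal projections on which given coset projections act as prescribed by a coset,
and which lie below the projection of a coset avoiding given affine conditions. -/
theorem exists_atom_compression [Infinite R] {P : ℕ → HeightOneSpectrum R}
    (hP : Function.Bijective P) {ι κ : Type*} [Finite ι] [Finite κ] (y : ι → R)
    (J : ι → NonzeroIdeal R) (b z : κ → R) (hbz : ∀ j, b j ≠ 0 ∨ z j ≠ 0) (x : R)
    (I : NonzeroIdeal R) :
    ∃ n, 1 ≤ n ∧ ∃ q ∈ D P n, q ≠ 0 ∧
      (∀ i, (I.1 ≤ (J i).1 ∧ x - y i ∈ (J i).1) → cosetProj (y i) (J i) * q = q) ∧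
      (∀ i, ¬ (I.1 ≤ (J i).1 ∧ x - y i ∈ (J i).1) → cosetProj (y i) (J i) * q = 0) ∧
      ∃ x' L, cosetProj x' L * q = q ∧ ∀ j, b j * x' + z j ∉ L.1 := by
  -- The coset x + I is infinite, and each of the finitely many affine conditions excludes at most
  -- one point.
  obtain ⟨x', hxI, hx'⟩ : ∃ x', x' - x ∈ I.1 ∧ ∀ j, b j * x' + z j ≠ 0 := by
    obtain ⟨r0, hr0, hr0'⟩ := Submodule.exists_mem_ne_zero_of_ne_bot I.2
    have hinf : (Set.range fun r : R => x + r * r0).Infinite :=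
      Set.infinite_range_of_injective fun r r' h => mul_right_cancel₀ hr0' (add_left_cancel h)
    have hfin : (⋃ j, {w | b j * w + z j = 0}).Finite := by
      refine Set.finite_iUnion fun j => ?_
      by_cases hb : b j = 0
      · convert Set.finite_empty
        ext w
        have := (hbz j).resolve_left (not_not.2 hb)
        simpa [hb] using this
      · exact Set.Subsingleton.finite fun w hw w' hw' => mul_left_cancel₀ hb
          (add_right_cancel ((show b j * w + z j = 0 from hw).trans
            (show b j * w' + z j = 0 from hw').symm))
    obtain ⟨w, ⟨r, rfl⟩, hw⟩ := (hinf.sdiff hfin).nonempty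
    refine ⟨_, ?_, fun j hj => hw (Set.mem_iUnion.2 ⟨j, hj⟩)⟩
    simpa using I.1.mul_mem_left r hr0
  -- All primes dividing some J_i have index below N, which leaves P_N free for separating.
  obtain ⟨N, hN⟩ : ∃ N, ∀ i (v : HeightOneSpectrum R), (J i).1 ≤ v.asIdeal → ∃ m < N, P m = v := by
    have hfin : (⋃ i, {m | (P m).asIdeal ∣ (J i).1}).Finite :=
      Set.finite_iUnion fun i => Set.Finite.preimage (f := P) hP.injective.injOn
        (Ideal.finite_factors (J i).2)
    obtain ⟨N, hN⟩ := hfin.bddAbove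
    refine ⟨N + 1, fun i v hv => ?_⟩
    obtain ⟨m, rfl⟩ := hP.surjective v
    exact ⟨m, Nat.lt_succ_of_le (hN (Set.mem_iUnion.2 ⟨i, Ideal.dvd_iff_le.2 hv⟩)), rfl⟩
  -- By Krull's intersection theorem the powers of P_N meet in zero, so a high power omits the
  -- finitely many non-zero values.
  obtain ⟨k0, hk0⟩ : ∃ k0, ∀ j, b j * x' + z j ∉ (P N).asIdeal ^ k0 := by
    have h1 : ∀ j, ∃ k0, b j * x' + z j ∉ (P N).asIdeal ^ k0 := by
      intro j
      by_contra! h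
      refine hx' j ?_
      have h2 : b j * x' + z j ∈ (⨅ i : ℕ, (P N).asIdeal ^ i) := (Submodule.mem_iInf _).2 h
      rwa [Ideal.iInf_pow_eq_bot_of_isDomain _ (P N).isPrime.ne_top] at h2
    choose k hk using h1
    obtain ⟨M, hM⟩ := (Set.finite_range k).bddAbove
    exact ⟨M, fun j h => hk j (Ideal.pow_le_pow_right (hM ⟨j, rfl⟩) h)⟩
  -- At every prime that can divide a J_i the atom receives the exponent of I, so the J_i act on it
  -- as they would on x + I. The exponent at P_N serves only the affine conditions.
  let k : ℕ → ℕ := fun m => if m < N then multiplicity (P m).asIdeal I.1 else k0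
  have hk : ∀ m < N, ∀ l, I.1 ≤ (P m).asIdeal ^ l ↔ l ≤ k m := by
    intro m hm l
    rw [← Ideal.dvd_iff_le, (FiniteMultiplicity.of_prime_left (P m).prime
      I.2).pow_dvd_iff_le_multiplicity]
    simp [k, hm]
  have hJP : ∀ i (v : HeightOneSpectrum R) (l : ℕ), (J i).1 ≤ v.asIdeal ^ l → l ≠ 0 →
      ∃ m < N, P m = v := fun i v l hl hl0 => hN i v (hl.trans (Ideal.pow_le_self hl0))
  obtain ⟨A, hA, hA'⟩ := exists_cosetProj_mul_atom P (N + 1) x' k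
  have hself : ∀ i, I.1 ≤ (J i).1 →
      cosetProj x' (J i) * atom P (N + 1) x' k = atom P (N + 1) x' k := by
    intro i hi
    have hAJ : A.1 ≤ (J i).1 := by
      rw [ideal_le_iff_forall_pow_le (J i).2]
      intro v l hl
      rcases eq_or_ne l 0 with rfl | hl0
      · simp
      obtain ⟨m, hm, rfl⟩ := hJP i v l hl hl0
      exact (hA m (by omega)).trans (Ideal.pow_le_pow_right ((hk m hm l).1 (hi.trans hl)))
    rw [← hA', ← mul_assoc, cosetProj_mul_comm, cosetProj_mul_of_le hAJ (by simp)]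
  refine ⟨N + 1, by omega, atom P (N + 1) x' k, atom_mem _ _ _ _, atom_ne_zero hP.injective _ _ _,
    fun i hi => ?_, fun i hi => ?_, x', primePow (P N) (k N), cosetProj_mul_atom_self (by omega) _ _,
    ?_⟩
  · have h1 : y i - x' ∈ (J i).1 := by
      have : y i - x' = -(x' - x) - (x - y i) := by ring
      rw [this]
      exact sub_mem (neg_mem (hi.1 hxI)) hi.2
    rw [cosetProj_eq h1, hself i hi.1]
  · by_cases hIJ : I.1 ≤ (J i).1
    · rw [← hself i hIJ, ← mul_assoc, cosetProj_mul_eq_zero (J i).1 le_rfl le_rfl, zero_mul]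
      intro h1
      refine hi ⟨hIJ, ?_⟩
      have : x - y i = -(x' - x) - (y i - x') := by ring
      rw [this]
      exact sub_mem (neg_mem (hIJ hxI)) h1
    -- If I is not contained in J_i, some prime power P_m^l contains J_i but not I. Then l exceeds
    -- the exponent of the atom at P_m, and the atom is annihilated.
    · rw [ideal_le_iff_forall_pow_le (J i).2] at hIJ
      push Not at hIJ
      obtain ⟨v, l, hl, hl'⟩ := hIJ
      obtain ⟨m, hm, rfl⟩ := hJP i v l hl (by rintro rfl; simp at hl')
      rw [hk m hm, not_le] at hl'
      exact cosetProj_mul_atom_eq_zero (by omega : m < N + 1) x' k (y i)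
        (hl.trans (Ideal.pow_le_pow_right hl'))
  · have : k N = k0 := by simp [k]
    rw [this]
    exact hk0

end

end ToeplitzAlgebra

namespace ToeplitzAlgebra

open IsDedekindDomain

/-! ### Norms of combinations of coset projections -/

section

variable {R : Type*} [CommRing R] [IsDomain R]

open Classical in
/-- The norm of a combination of coset projections is bounded by its value at some coset. -/
theorem exists_norm_sum_cosetProj_le {ι : Type*} [Fintype ι] (c : ι → ℂ) (y : ι → R)
    (J : ι → NonzeroIdeal R) :
    ∃ (x : R) (I : NonzeroIdeal R), ‖∑ i, c i • cosetProj (y i) (J i)‖ ≤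
      ‖∑ i with I.1 ≤ (J i).1 ∧ x - y i ∈ (J i).1, c i‖ := by
  obtain ⟨S, hS, hχ⟩ := exists_subalgebra_character
    (s := {p : ToeplitzAlgebra R | IsCosetProj p}) (fun p hp q hq => hp.mul_comm hq)
    (fun p hp => hp.star_eq)
  let e : R → NonzeroIdeal R → S := fun x I => ⟨cosetProj x I, hS (isCosetProj_cosetProj x I)⟩
  obtain ⟨χ, -, hχd⟩ := hχ (∑ i, c i • e (y i) (J i))
  have hval : ∀ x I, χ (e x I) = 0 ∨ χ (e x I) = 1 := by
    intro x I
    have h1 : e x I * e x I = e x I := Subtype.ext (cosetProj_mul_of_le le_rfl (by simp))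
    have h2 := congrArg χ h1
    rw [map_mul] at h2
    rcases eq_or_ne (χ (e x I)) 0 with h | h
    · exact Or.inl h
    · exact Or.inr (mul_left_cancel₀ h (h2.trans (mul_one _).symm))
  -- The cosets on which χ takes the value 1 can be intersected one after another: a product of
  -- value 1 is not zero, so the intersection is never empty.
  have hex : ∀ T : Finset ι, ∃ x I, χ (e x I) = 1 ∧ ∀ i ∈ T, χ (e (y i) (J i)) = 1 →
      I.1 ≤ (J i).1 ∧ x - y i ∈ (J i).1 := by
    intro T
    induction T using Finset.induction_on with
    | empty =>
      refine ⟨0, NonzeroIdeal.top, ?_, by simp⟩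
      have : e 0 NonzeroIdeal.top = 1 := Subtype.ext (cosetProj_top 0)
      rw [this, map_one]
    | insert i T _ ih =>
      obtain ⟨x, I, hxI, hT⟩ := ih
      rcases hval (y i) (J i) with h0 | h1
      · refine ⟨x, I, hxI, fun j hj hj1 => ?_⟩
        rcases Finset.mem_insert.1 hj with rfl | hj
        · rw [h0] at hj1
          exact absurd hj1 zero_ne_one
        · exact hT j hj hj1
      · have hprod : χ (e x I * e (y i) (J i)) = 1 := by rw [map_mul, hxI, h1, one_mul]
        rcases cosetProj_mul_cosetProj x (y i) I (J i) with h | ⟨w, hw, hw', h⟩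
        · have : e x I * e (y i) (J i) = 0 := Subtype.ext h
          rw [this, map_zero] at hprod
          exact absurd hprod zero_ne_one
        · refine ⟨w, I.inf (J i), ?_, fun j hj hj1 => ?_⟩
          · have : e x I * e (y i) (J i) = e w (I.inf (J i)) := Subtype.ext h
            rw [← this, hprod]
          · rcases Finset.mem_insert.1 hj with rfl | hj
            · exact ⟨inf_le_right, hw'⟩
            · obtain ⟨h3, h4⟩ := hT j hj hj1
              refine ⟨inf_le_left.trans h3, ?_⟩
              have : w - y j = (w - x) + (x - y j) := by ring
              rw [this]
              exact add_mem (h3 hw) h4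
  obtain ⟨x, I, hxI, hT⟩ := hex Finset.univ
  refine ⟨x, I, le_of_eq ?_⟩
  have h1 : ‖∑ i, c i • cosetProj (y i) (J i)‖ = ‖∑ i, c i • e (y i) (J i)‖ := by
    have : ((∑ i, c i • e (y i) (J i) : S) : ToeplitzAlgebra R) =
        ∑ i, c i • cosetProj (y i) (J i) := by
      rw [AddSubmonoidClass.coe_finsetSum]
      rfl
    rw [← this]
    rfl
  rw [h1, ← hχd, map_sum, Finset.sum_filter]
  congr 1
  refine Finset.sum_congr rfl fun i _ => ?_
  rw [map_smul, smul_eq_mul]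
  -- If x + I is contained in y_i + J_i, the value 1 at the smaller projection forces the value 1 at
  -- the larger one.
  split_ifs with h
  · have h2 : e x I * e (y i) (J i) = e x I := Subtype.ext (cosetProj_mul_of_le h.1 h.2)
    have h3 := congrArg χ h2
    rw [map_mul, hxI, one_mul] at h3
    rw [h3, mul_one]
  · rw [(hval (y i) (J i)).resolve_right fun h2 => h (hT i (Finset.mem_univ i) h2), mul_zero]

end

section

variable {R : Type*} [CommRing R] [IsDedekindDomain R] [Ring.HasFiniteQuotients R] [Infinite R]

open Classical in
/-- If a homomorphism is injective on the algebras `D_n`, the norm of the part of degree one of an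
element of the dense subalgebra is bounded by the norm of the image of the element. -/
theorem norm_sum_degree_one_le {P : ℕ → HeightOneSpectrum R} (hP : Function.Bijective P)
    {A : Type*} [NonUnitalCStarAlgebra A] (α : ToeplitzAlgebra R →⋆ₙₐ[ℂ] A)
    (hα : ∀ n, 1 ≤ n → Set.InjOn α (D P n)) {n : ℕ} (c : Fin n → ℂ) (a b : Fin n → R⁰)
    (z : Fin n → R) (p : Fin n → ToeplitzAlgebra R) (hp : ∀ i, IsCosetProj (p i)) :
    ‖∑ i with a i = b i ∧ z i = 0, c i • (star (s (a i)) * p i * u (z i) * s (b i))‖ ≤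
      ‖α (∑ i, c i • (star (s (a i)) * p i * u (z i) * s (b i)))‖ := by
  set t : Fin n → ToeplitzAlgebra R := fun i => star (s (a i)) * p i * u (z i) * s (b i) with ht
  -- A non-zero term of degree one has the form s_a^* p s_a, hence is a coset projection. For all
  -- other indices the coset is a dummy value.
  have hcoset : ∀ i, ∃ (y : R) (J : NonzeroIdeal R), a i = b i ∧ z i = 0 → t i ≠ 0 →
      t i = cosetProj y J := by
    intro i
    by_cases h : (a i = b i ∧ z i = 0) ∧ t i ≠ 0
    · have h1 : t i = star (s (a i)) * p i * s (a i) := by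
        rw [ht]
        simp only
        rw [h.1.2, u_zero, mul_one, h.1.1]
      obtain ⟨y, J, hyJ⟩ := ((hp i).star_s_mul_mul_s (a i)).resolve_left (h1 ▸ h.2)
      exact ⟨y, J, fun _ _ => h1.trans hyJ⟩
    · exact ⟨0, NonzeroIdeal.top, fun h1 h2 => absurd ⟨h1, h2⟩ h⟩
  choose y J hyJ using hcoset
  let ι := {i : Fin n // (a i = b i ∧ z i = 0) ∧ t i ≠ 0}
  let κ := {i : Fin n // ¬ (a i = b i ∧ z i = 0)}
  have hd : ∑ i with a i = b i ∧ z i = 0, c i • t i =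
      ∑ i : ι, c i • cosetProj (y i) (J i) := by
    have h1 : ∑ i with (a i = b i ∧ z i = 0) ∧ t i ≠ 0, c i • t i =
        ∑ i with a i = b i ∧ z i = 0, c i • t i := by
      refine Finset.sum_subset (fun i hi => ?_) fun i hi hi' => ?_
      · simp only [Finset.mem_filter] at hi ⊢
        exact ⟨hi.1, hi.2.1⟩
      · simp only [Finset.mem_filter, not_and, not_not] at hi hi'
        rw [hi' hi.1 hi.2, smul_zero]
    rw [← h1, Finset.sum_subtype (p := fun i => (a i = b i ∧ z i = 0) ∧ t i ≠ 0) _ (by simp)]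
    exact Finset.sum_congr rfl fun i _ => by rw [hyJ i i.2.1 i.2.2]
  obtain ⟨x, I, hxI⟩ := exists_norm_sum_cosetProj_le (fun i : ι => c i) (fun i => y i) fun i => J i
  -- The condition (b_j - a_j) x' + z_j ∉ L is the one under which x' + L compresses the j-th
  -- monomial to zero; its coefficients are not both zero as the degree is non-trivial.
  obtain ⟨m, hm, q, hqD, hq0, hq1, hq2, x', L, hq3, hq4⟩ := exists_atom_compression hP
    (fun i : ι => y i) (fun i => J i) (fun j : κ => (b j : R) - a j) (fun j => z j) (fun j => by
      by_contra! h
      exact j.2 ⟨Subtype.ext (sub_eq_zero.1 h.1).symm, h.2⟩) x I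
  set l : ℂ := ∑ i ∈ (Finset.univ : Finset ι).filter
    (fun i : ι => I.1 ≤ (J i.1).1 ∧ x - y i.1 ∈ (J i.1).1), c i.1 with hl
  have hone : (∑ i with a i = b i ∧ z i = 0, c i • t i) * q = l • q := by
    rw [hd, Finset.sum_mul, hl, Finset.sum_smul, Finset.sum_filter]
    refine Finset.sum_congr rfl fun i _ => ?_
    rw [smul_mul_assoc]
    split_ifs with h
    · rw [hq1 i h]
    · rw [hq2 i h, smul_zero]
  have hzero : star q * (∑ i with ¬ (a i = b i ∧ z i = 0), c i • t i) * q = 0 := by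
    rw [Finset.mul_sum, Finset.sum_mul]
    refine Finset.sum_eq_zero fun i hi => ?_
    have h1 := cosetProj_mul_monomial_mul_cosetProj (hp i)
      (hq4 ⟨i, (Finset.mem_filter.1 hi).2⟩)
    have h2 : star q * cosetProj x' L = star q := by
      rw [← star_cosetProj, ← star_mul, hq3]
    have h3 : star q * t i * q = 0 :=
      calc star q * t i * q = (star q * cosetProj x' L) * t i * (cosetProj x' L * q) := by
            rw [h2, hq3]
        _ = star q * (cosetProj x' L * t i * cosetProj x' L) * q := by simp only [mul_assoc]
        _ = 0 := by rw [h1, mul_zero, zero_mul]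
    rw [mul_smul_comm, smul_mul_assoc, h3, smul_zero]
  -- Working with q^* q avoids having to know that q is a projection.
  have hcomp : star q * (∑ i, c i • t i) * q = l • (star q * q) := by
    rw [← Finset.sum_filter_add_sum_filter_not Finset.univ (fun i => a i = b i ∧ z i = 0),
      mul_add, add_mul, hzero, add_zero, mul_assoc, hone, mul_smul_comm]
  have hαq : α q ≠ 0 := fun h => hq0 (hα m hm hqD (zero_mem _) (by rw [h, map_zero]))
  have hnorm := congrArg (fun w => ‖α w‖) hcomp
  simp only [map_smul, map_mul, map_star, norm_smul, CStarRing.norm_star_mul_self] at hnorm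
  have h1 : ‖star (α q) * α (∑ i, c i • t i) * α q‖ ≤
      ‖α q‖ * ‖α (∑ i, c i • t i)‖ * ‖α q‖ := by
    refine (norm_mul_le _ _).trans (mul_le_mul_of_nonneg_right ?_ (norm_nonneg _))
    exact (norm_mul_le _ _).trans_eq (by rw [norm_star])
  have h2 : 0 < ‖α q‖ := norm_pos_iff.2 hαq
  have h3 : ‖l‖ * (‖α q‖ * ‖α q‖) ≤ ‖α (∑ i, c i • t i)‖ * (‖α q‖ * ‖α q‖) := by
    rw [← hnorm]
    refine h1.trans_eq ?_
    ring
  rw [hd]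
  exact hxI.trans (le_of_mul_le_mul_right h3 (mul_pos h2 h2))

/-- A homomorphism which is injective on the algebras `D_n` is injective. -/
theorem injective_of_injOn_D (K : Type*) [Field K] [Algebra R K] [IsFractionRing R K]
    {P : ℕ → HeightOneSpectrum R} (hP : Function.Bijective P)
    {A : Type*} [NonUnitalCStarAlgebra A] (α : ToeplitzAlgebra R →⋆ₙₐ[ℂ] A)
    (hα : ∀ n, 1 ≤ n → Set.InjOn α (D P n)) : Function.Injective α := by
  classical
  rw [injective_iff_map_eq_zero]
  intro y hy
  by_contra hy0
  obtain ⟨H, _, _, _, π, hπ⟩ := exists_representation_ne_zero hy0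
  refine hπ (eq_zero_of_gradedRep_single_eq_zero (K := K) π fun q v => ?_)
  have hαc : Continuous α := AddMonoidHomClass.continuous_of_bound α 1
    fun x => by rw [one_mul]; exact NonUnitalStarAlgHom.norm_apply_le α x
  have hδc : Continuous (gradedRep K π) := AddMonoidHomClass.continuous_of_bound (gradedRep K π) 1
    fun x => by rw [one_mul]; exact NonUnitalStarAlgHom.norm_apply_le (gradedRep K π) x
  -- On the dense span the coefficient is that of π at the part of degree one, so domination
  -- applies; both sides are continuous in x.
  have hbound : ∀ x : ToeplitzAlgebra R,
      ‖inner ℂ (L2.single q v) (gradedRep K π x (L2.single q v))‖ ≤ ‖α x‖ * (‖v‖ * ‖v‖) := by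
    have hclosed : IsClosed {x : ToeplitzAlgebra R |
        ‖inner ℂ (L2.single q v) (gradedRep K π x (L2.single q v))‖ ≤ ‖α x‖ * (‖v‖ * ‖v‖)} := by
      refine isClosed_le (continuous_norm.comp ?_) ((continuous_norm.comp hαc).mul continuous_const)
      exact continuous_const.inner (hδc.clm_apply continuous_const)
    intro x
    refine hclosed.closure_subset_iff.2 (fun x hx => ?_) (dense_span_monomials x)
    obtain ⟨n, c, a, b, z, p, hp, rfl⟩ := exists_sum_monomials hx
    rw [Set.mem_ofPred_eq, inner_gradedRep_single π c a b z p hp]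
    calc _ ≤ ‖v‖ * (‖π (∑ i with a i = b i ∧ z i = 0,
            c i • (star (s (a i)) * p i * u (z i) * s (b i)))‖ * ‖v‖) :=
          (norm_inner_le_norm _ _).trans
            (mul_le_mul_of_nonneg_left (ContinuousLinearMap.le_opNorm _ _) (norm_nonneg _))
      _ ≤ ‖v‖ * (‖α (∑ i, c i • (star (s (a i)) * p i * u (z i) * s (b i)))‖ * ‖v‖) := by
          gcongr
          exact (NonUnitalStarAlgHom.norm_apply_le π _).trans
            (norm_sum_degree_one_le hP α hα c a b z p hp)
      _ = _ := by ring
  -- The coefficient at y^* y is the squared norm of the image of the one-entry family, and α(y^* y)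
  -- = 0.
  have h1 := hbound (star y * y)
  rw [map_mul α, hy, mul_zero, norm_zero, zero_mul, map_mul, map_star] at h1
  have h2 := norm_le_zero_iff.1 h1
  change inner ℂ (L2.single q v) (star (gradedRep K π y) (gradedRep K π y (L2.single q v))) = 0
    at h2
  rw [ContinuousLinearMap.star_eq_adjoint, ContinuousLinearMap.adjoint_inner_right] at h2
  exact inner_self_eq_zero.1 h2

end

/-! ### The inclusions between the subalgebras -/

section

variable {R : Type*} [CommRing R] [IsDedekindDomain R]

theorem cosetProj_mem_Dbar (x : R) (I : NonzeroIdeal R) : cosetProj x I ∈ Dbar R :=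
  NonUnitalStarSubalgebra.le_topologicalClosure _
    (NonUnitalStarAlgebra.subset_adjoin ℂ _ ⟨x, I, rfl⟩)

theorem isClosed_Dbar : IsClosed (Dbar R : Set (ToeplitzAlgebra R)) :=
  NonUnitalStarSubalgebra.isClosed_topologicalClosure _

theorem f_mem_Dbar (I : NonzeroIdeal R) : f I ∈ Dbar R :=
  finsum_induction (· ∈ Dbar R) (zero_mem _) (fun _ _ => add_mem)
    fun c => cosetProj_mem_Dbar (Quotient.out c) I

theorem DbarPrime_le_Dbar (P : HeightOneSpectrum R) : DbarPrime P ≤ Dbar R := by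
  refine NonUnitalStarSubalgebra.topologicalClosure_minimal _
    (NonUnitalStarAlgebra.adjoin_le ?_) isClosed_Dbar
  rintro _ ⟨x, n, rfl⟩
  exact cosetProj_mem_Dbar x _

theorem DPrime_le_Dbar (P : HeightOneSpectrum R) :
    (DPrime P : Set (ToeplitzAlgebra R)) ⊆ Dbar R := by
  refine Submodule.topologicalClosure_minimal (t := (Dbar R).toSubmodule) _
    (Submodule.span_le.2 ?_) isClosed_Dbar
  rintro _ ⟨d, hd, n, -, d', hd', rfl⟩
  change _ ∈ Dbar R
  exact mul_mem (mul_mem (DbarPrime_le_Dbar P hd) (sub_mem (f_mem_Dbar _) (f_mem_Dbar _)))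
    (DbarPrime_le_Dbar P hd')

theorem D_subset_Dbar (P : ℕ → HeightOneSpectrum R) (n : ℕ) :
    (D P n : Set (ToeplitzAlgebra R)) ⊆ Dbar R := by
  have key : ∀ L : List (Submodule ℂ (ToeplitzAlgebra R)), (∀ M ∈ L, M ≤ (Dbar R).toSubmodule) →
      L.prod ≤ (Dbar R).toSubmodule := by
    intro L
    induction L with
    | nil =>
      intro _
      -- The empty product consists of the scalars, which lie in D̄ because 1 = e_R.
      rw [List.prod_nil, Submodule.one_le]
      have h := cosetProj_mem_Dbar (0 : R) NonzeroIdeal.top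
      rwa [cosetProj_top] at h
    | cons M L ih =>
      intro h
      rw [List.prod_cons, Submodule.mul_le]
      intro m hm w hw
      exact mul_mem (S := NonUnitalStarSubalgebra ℂ (ToeplitzAlgebra R))
        (h M List.mem_cons_self hm) (ih (fun N hN => h N (List.mem_cons_of_mem M hN)) hw)
  refine Submodule.topologicalClosure_minimal (t := (Dbar R).toSubmodule) _ (key _ ?_) isClosed_Dbar
  intro M hM
  obtain ⟨i, rfl⟩ := (List.mem_ofFn' _ _).1 hM
  exact DPrime_le_Dbar (P i)

end

end ToeplitzAlgebra

end NumberFieldToeplitz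

end

/-! ### The equivalence for rings of integers. -/

theorem theorem4p13 {K : Type*} [Field K] [NumberField K]
    (P : ℕ → IsDedekindDomain.HeightOneSpectrum (𝓞 K)) (hP : Function.Bijective P)
    {A : Type*} [NonUnitalCStarAlgebra A]
    (α : NumberFieldToeplitz.ToeplitzAlgebra (𝓞 K) →⋆ₙₐ[ℂ] A) :
    List.TFAE [
      Function.Injective α,
      Set.InjOn α (NumberFieldToeplitz.ToeplitzAlgebra.Dbar (𝓞 K)),
      ∀ n : ℕ, 1 ≤ n → Set.InjOn α (NumberFieldToeplitz.ToeplitzAlgebra.D P n)] := by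
  tfae_have 1 → 2 := fun h => h.injOn
  tfae_have 2 → 3 := fun h n _ =>
    h.mono (NumberFieldToeplitz.ToeplitzAlgebra.D_subset_Dbar P n)
  tfae_have 3 → 1 := NumberFieldToeplitz.ToeplitzAlgebra.injective_of_injOn_D K hP α
  tfae_finish
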